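/- Biggins' Theorem. Let $\mathcal L=\{X_i\}_{i=1}^L$ be a random tuple of real numbers, where the length $L$ is random with values in $\{0,1,2,\dots\}\cup\{\infty\}$. Consider the branching random walk with reproduction law that of $\mathcal L$: an initial particle (the root, generation $0$) at the origin of $\mathbf R$ has $L$ children, displaced from it by $X_1,X_2,\dots$; every particle $\sigma$ has children displaced from its own position according to a copy $\mathcal L(\sigma)$ of $\mathcal L$, all these copies being independent; this continues forever or until there are no more particles. Write $|\sigma|$ for the generation of the particle $\sigma$ and $S(\sigma)$ for its position, and let $q$ be the probability that some generation is empty (the extinction probability). For $\alpha\in\mathbf R$ put $$\langle\alpha,\mathcal L\rangle:=\sum_{i=1}^L e^{-\alpha X_i},\qquad m(\alpha):=\mathbf E[\langle\alpha,\mathcal L\rangle]\in[0,\infty],\qquad m'(\alpha):=-\mathbf E\Bigl[\sum_{i=1}^L X_ie^{-\alpha X_i}\Bigr].$$ Assume that $m(0)>1$, and let $\alpha\in\mathbf R$ be such that $m(\alpha)<\infty$ and $m'(\alpha)$ exists as a Lebesgue integral and is finite, that is, $\mathbf E\bigl[\sum_{i=1}^L|X_i|e^{-\alpha X_i}\bigr]<\infty$.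 Then $$W_n(\alpha):=m(\alpha)^{-n}\sum_{|\sigma|=n}e^{-\alpha S(\sigma)}$$ converges almost surely to a finite limit $W(\alpha)$, and the following are equivalent: (i) $\mathbf P[W(\alpha)=0]=q$; (ii) $\mathbf P[W(\alpha)=0]<1$; (iii) $\mathbf E[W(\alpha)]=1$; (iv) $\mathbf E[\langle\alpha,\mathcal L\rangle\log^+\langle\alpha,\mathcal L\rangle]<\infty$ and $\alpha m'(\alpha)/m(\alpha)<\log m(\alpha)$. -/

import Mathlib

open MeasureTheory ProbabilityTheory Filter Topology
open scoped ENNReal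

namespace BRW

/-- A finite or infinite tuple `{X_i}_{i < L}` of real numbers, `L ∈ {0, 1, 2, …, ∞}`, coded as the
pair of its length `L` and the sequence of its entries, continued by zeros beyond the length. -/
abbrev Tuple : Type := {t : ℕ∞ × (ℕ → ℝ) // ∀ i : ℕ, t.1 ≤ (i : ℕ∞) → t.2 i = 0}

/-- The length `L` of a tuple. -/
def Tuple.len (t : Tuple) : ℕ∞ := t.1.1

/-- The `i`-th entry `X_i` of a tuple, counted from `0` (meaningful for `i < L`). -/
def Tuple.entry (t : Tuple) (i : ℕ) : ℝ := t.1.2 i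

noncomputable section

open Classical in
/-- `⟨α, 𝓛⟩ = ∑_{i < L} exp (-α X_i)`, a sum in `[0, ∞]`. -/
def pairing (α : ℝ) (t : Tuple) : ℝ≥0∞ :=
  ∑' i : ℕ, if (i : ℕ∞) < t.len then ENNReal.ofReal (Real.exp (-α * t.entry i)) else 0

/-- `m(α) = E ⟨α, 𝓛⟩ ∈ [0, ∞]`, where `ν` is the law of `𝓛`. -/
def m (ν : Measure Tuple) (α : ℝ) : ℝ≥0∞ := ∫⁻ t, pairing α t ∂ν

open Classical in
/-- The summand `X_i exp (-α X_i)` for `i < L`, and `0` for `i ≥ L`. -/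
def derivTerm (α : ℝ) (t : Tuple) (i : ℕ) : ℝ :=
  if (i : ℕ∞) < t.len then t.entry i * Real.exp (-α * t.entry i) else 0

/-- `m'(α)` exists as a Lebesgue integral and is finite: the integral of `|X_i| exp (-α X_i)` over
the sample space and the indices `i < L` is finite. -/
def FiniteDeriv (ν : Measure Tuple) (α : ℝ) : Prop :=
  ∫⁻ t, ∑' i : ℕ, ‖derivTerm α t i‖ₑ ∂ν < ∞

/-- `m'(α) = -E [∑_{i < L} X_i exp (-α X_i)]`, used only under `FiniteDeriv ν α`. The minus sign
comes from differentiating `exp (-α X_i)` with respect to `α`. -/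
def mDeriv (ν : Measure Tuple) (α : ℝ) : ℝ := -∫ t, ∑' i : ℕ, derivTerm α t i ∂ν

/-- `log⁺ x = max (log x) 0` on `[0, ∞]`, with `log⁺ ∞ = ∞`. -/
def logPlus (x : ℝ≥0∞) : ℝ≥0∞ := (ENNReal.log x).toENNReal

variable {Ω : Type*}

/-- The potential particles are the words `σ : List ℕ`: the root is `[]`, and `i :: σ` is the `i`-th
child of `σ`, so that the newest letter comes first and `|σ|` is the length of the word. Given the
tuples `𝓛 σ` that generate the children of the particles, `Born 𝓛 ω σ` says that `σ` is a particle
of the branching random walk. -/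
def Born (𝓛 : List ℕ → Ω → Tuple) (ω : Ω) : List ℕ → Prop
  | [] => True
  | i :: σ => Born 𝓛 ω σ ∧ (i : ℕ∞) < (𝓛 σ ω).len

/-- The position `S(σ) = ∑_{0 < τ ≤ σ} X(τ)` of the particle `σ`, where the displacement `X(i :: σ)`
of the `i`-th child of `σ` is the `i`-th entry of `𝓛 σ`. -/
def position (𝓛 : List ℕ → Ω → Tuple) (ω : Ω) : List ℕ → ℝ
  | [] => 0
  | i :: σ => position 𝓛 ω σ + (𝓛 σ ω).entry i

/-- The set of particles of generation `n`. -/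
def generation (𝓛 : List ℕ → Ω → Tuple) (n : ℕ) (ω : Ω) : Set (List ℕ) :=
  {σ | σ.length = n ∧ Born 𝓛 ω σ}

/-- The event that the underlying Galton-Watson process becomes extinct. -/
def extinction (𝓛 : List ℕ → Ω → Tuple) : Set Ω := {ω | ∃ n : ℕ, generation 𝓛 n ω = ∅}

/-- `W_n(α) = m(α)^{-n} ∑_{|σ| = n} exp (-α S(σ))`. -/
def additiveMartingale (ν : Measure Tuple) (𝓛 : List ℕ → Ω → Tuple) (α : ℝ) (n : ℕ) (ω : Ω) :
    ℝ≥0∞ :=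
  (∑' σ : generation 𝓛 n ω, ENNReal.ofReal (Real.exp (-α * position 𝓛 ω σ))) / m ν α ^ n

/-- `W(α)`, the limit of `W_n(α)`, set equal to the upper limit at every sample point. -/
def limitW (ν : Measure Tuple) (𝓛 : List ℕ → Ω → Tuple) (α : ℝ) (ω : Ω) : ℝ≥0∞ :=
  limsup (fun n : ℕ => additiveMartingale ν 𝓛 α n ω) atTop

/-- The tuples `𝓛 σ` are independent random tuples with common law `ν`, so that they generate a
branching random walk with reproduction law `ν`. -/
structure IsBranchingRandomWalk [MeasurableSpace Ω] (P : Measure Ω) (ν : Measure Tuple)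
    (𝓛 : List ℕ → Ω → Tuple) : Prop where
  measurable : ∀ σ, Measurable (𝓛 σ)
  law : ∀ σ, P.map (𝓛 σ) = ν
  indep : iIndepFun 𝓛 P

end

end BRW

/-! Dividing the weights `exp (-α X_i)` by `m(α)` gives random weights `a` with E ∑ a_i = 1. The
generation masses form a nonnegative martingale of mean 1 with a.s. limit W. Fatou gives ∑ a_i W_i ≤
W for the limits W_i of the subtrees, and both sides have the same finite mean, so W = ∑ a_i W_i
a.s. (`ae_limitMass_eq`). If P[W = 0] < 1, then P[W = 0] and q are fixed points below 1 of the
offspring generating function. By strict convexity there is at most one when m(0) > 1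
(`pgf_fixedPoint_unique`), so (ii) gives (i). The converse is q < 1
(`treeLaw_extinctionSet_lt_one`).

Let X = ∑ a_i, and let Q be the law of the root label biased by X, together with a child chosen in
proportion to its weight A (`spineLaw`). Then κ = E_Q log A equals α m'(α)/m(α) - log m(α), so the
second half of (iv) says κ < 0.

(ii) ⇒ (iv). Bias further by the limit V of the chosen subtree (`tiltedLaw`). Then V and U = ∑ a_i
W_i both have the size-biased law of W (`map_branchSum_tiltedLaw`), and U ≥ A V gives log U - log V
≥ log A, which is integrable. A difference of equally distributed variables with integrable negative
part is integrable, with mean at most 0 (`lintegral_ofReal_sub_le_of_map_eq`). If κ ≥ 0, this forces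
U = A V, so there is at most one child, contrary to m(0) > 1 (`integral_logWeight_neg`). Restricting
to V ≤ K bounds a biased mean of log⁺(U/K). Since a truncated version of U has conditional mean
proportional to X given the root, X log⁺ X is integrable
(`lintegral_mul_logPlus_lt_top_of_limitMass`).

(iv) ⇒ (iii). Under the bias by W_n, a spine appears, along which W_n is controlled by the
perpetuity X_0 + A_0 (X_1 + A_1 (⋯)) with independent steps of law Q. Concavity of min(1, ·) makes
this an inequality for E[W_n min(1, c W_n)] (`tailMean_le`). By the strong law the products of the
A's decay like exp(κ n), while E_Q log⁺ X < ∞ makes the X_n subexponential, so one a.s. finite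
variable bounds all depths (`ae_perpetuityBound_lt_top`). Thus no mass escapes, and E W = 1
(`lintegral_limitMass_eq_one`). Finally (iii) clearly gives (ii). -/

namespace Cascade

/-! ### Independence in product spaces and the branching property. -/

section ProductMeasure

variable {X κ ι : Type*} [MeasurableSpace X] (ν : Measure X) [IsProbabilityMeasure ν]

/-- Splitting off one coordinate of an infinite product of copies of the same measure. -/
lemma measurePreserving_option_split :
    MeasurePreserving (fun x : Option κ → X => (x none, fun k => x (some k)))
      (Measure.infinitePi fun _ => ν) (ν.prod (Measure.infinitePi fun _ => ν)) := by
  have hg : Measurable (fun p : X × (κ → X) => (fun o : Option κ => o.elim p.1 p.2)) := by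
    refine measurable_pi_lambda _ fun o => ?_
    cases o <;> simp <;> fun_prop
  have hh : Measurable (fun x : Option κ → X => (x none, fun k => x (some k))) := by fun_prop
  have key : (ν.prod (Measure.infinitePi fun _ : κ => ν)).map
      (fun p : X × (κ → X) => (fun o : Option κ => o.elim p.1 p.2)) =
      Measure.infinitePi fun _ => ν := by
    classical
    refine Measure.eq_infinitePi _ fun s t ht => ?_
    rw [Measure.map_apply hg (.pi s.countable_toSet fun i _ => ht i)]
    have : (fun p : X × (κ → X) => (fun o : Option κ => o.elim p.1 p.2)) ⁻¹' (Set.pi s t) =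
        (if none ∈ s then t none else Set.univ) ×ˢ
          Set.pi (Finset.eraseNone s : Set κ) (fun k => t (some k)) := by
      ext p
      simp only [Set.mem_preimage, Set.mem_pi, SetLike.mem_coe, Option.forall, Option.elim_none,
        Option.elim_some, Set.mem_prod, Finset.mem_eraseNone]
      split_ifs with h <;> simp [h]
    rw [this, Measure.prod_prod, Measure.infinitePi_pi _ (fun i _ => ht _)]
    by_cases h : none ∈ s
    · rw [if_pos h]
      conv_rhs => rw [← Finset.insert_erase h, ← Finset.map_some_eraseNone]
      rw [Finset.prod_insert (by simp), Finset.prod_map]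
      rfl
    · rw [if_neg h, measure_univ, one_mul]
      conv_rhs => rw [← Finset.erase_eq_of_notMem h, ← Finset.map_some_eraseNone]
      rw [Finset.prod_map]
      rfl
  refine ⟨hh, ?_⟩
  rw [← key, Measure.map_map hh hg]
  exact Measure.map_id

/-- A box in the new coordinates pulls back to a box over the image of `e`; injectivity leaves
exactly one constraint on each coordinate there. Every independence statement about subtrees below
comes from choosing a suitable `e`. -/
lemma measurePreserving_infinitePi_comp {e : κ → ι} (he : Function.Injective e) :
    MeasurePreserving (fun (x : ι → X) k => x (e k))
      (Measure.infinitePi fun _ => ν) (Measure.infinitePi fun _ => ν) := by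
  refine ⟨by fun_prop, ?_⟩
  classical
  refine Measure.eq_infinitePi _ fun s t ht => ?_
  rw [Measure.map_apply (by fun_prop) (.pi s.countable_toSet fun i _ => ht i)]
  have : (fun (x : ι → X) k => x (e k)) ⁻¹' (Set.pi s t) =
      Set.pi (s.image e : Set ι) (fun i => {z | ∀ k, e k = i → z ∈ t k}) := by
    ext x
    simp only [Set.mem_preimage, Set.mem_pi, Finset.coe_image, Set.mem_image, SetLike.mem_coe,
      Set.mem_ofPred_eq, forall_exists_index, and_imp]
    constructor
    · rintro h i k hk rfl k' hk'
      rw [he hk']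
      exact h _ hk
    · intro h k hk
      exact h _ k hk rfl _ rfl
  have h2 : ∀ k, {z | ∀ k', e k' = e k → z ∈ t k'} = t k := by
    intro k
    ext z
    exact ⟨fun h => h k rfl, fun h k' hk' => he hk' ▸ h⟩
  rw [this, Measure.infinitePi_pi]
  · rw [Finset.prod_image (fun a _ b _ h => he h)]
    simp_rw [h2]
  · intro i hi
    obtain ⟨k, -, rfl⟩ := Finset.mem_image.1 hi
    rw [h2]
    exact ht k

lemma measurePreserving_head_tail :
    MeasurePreserving (fun x : ℕ → X => (x 0, fun n => x (n + 1)))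
      (Measure.infinitePi fun _ => ν) (ν.prod (Measure.infinitePi fun _ => ν)) := by
  have he : Function.Injective (fun o : Option ℕ => o.elim 0 (· + 1)) := by
    rintro (_ | a) (_ | b) h <;> simp_all
  exact (measurePreserving_option_split ν).comp (measurePreserving_infinitePi_comp ν he)

/-- The subtree of descendants of the `i`-th child of the root. -/
def shift (i : ℕ) (x : List ℕ → X) (τ : List ℕ) : X := x (τ ++ [i])

/-- The label of the root and the subtrees of its children are independent. -/
lemma measurePreserving_root_split :
    MeasurePreserving (fun x : List ℕ → X => (x [], fun i => shift i x))
      (Measure.infinitePi fun _ => ν)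
      (ν.prod (Measure.infinitePi fun _ => Measure.infinitePi fun _ => ν)) := by
  -- The newest letter comes first, so the ancestor in generation 1 is read off the end of the word.
  have he : Function.Injective
      (fun o : Option (ℕ × List ℕ) => o.elim [] (fun p => p.2 ++ [p.1])) := by
    rintro (_ | a) (_ | b) h
    · rfl
    · simp at h
    · simp at h
    · simp only [Option.elim_some] at h
      obtain ⟨h1, h2⟩ := List.append_inj' h rfl
      simp only [List.cons.injEq, and_true] at h2
      rw [Prod.ext h2 h1]
  have hc : MeasurePreserving (MeasurableEquiv.curry ℕ (List ℕ) X)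
      (Measure.infinitePi fun _ => ν) (Measure.infinitePi fun _ => Measure.infinitePi fun _ => ν) :=
    ⟨MeasurableEquiv.measurable _, Measure.infinitePi_map_curry (fun _ _ => ν)⟩
  exact ((MeasurePreserving.id ν).prod hc).comp
    ((measurePreserving_option_split ν).comp (measurePreserving_infinitePi_comp ν he))

end ProductMeasure

lemma measurable_ennreal_tsum {α ι : Type*} {mα : MeasurableSpace α} [Countable ι]
    {f : ι → α → ℝ≥0∞} (h : ∀ i, Measurable (f i)) : Measurable fun x => ∑' i, f i x :=
  Measurable.tsum h

/-! ### Multiplicative cascades and their martingale. -/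

section Mass

variable {E : Type*} (a : E → ℕ → ℝ≥0∞)

/-- The product of the weights `a` along the path from the root to `σ`. -/
noncomputable def weight (x : List ℕ → E) : List ℕ → ℝ≥0∞
  | [] => 1
  | i :: σ => weight x σ * a (x σ) i

/-- The total weight of generation `n`. -/
noncomputable def mass (n : ℕ) (x : List ℕ → E) : ℝ≥0∞ :=
  ∑' σ : {σ : List ℕ // σ.length = n}, weight a x σ

/-- The upper limit of the total weights of the generations. -/
noncomputable def limitMass (x : List ℕ → E) : ℝ≥0∞ := limsup (fun n => mass a n x) atTop

lemma weight_append (x : List ℕ → E) (i : ℕ) (τ : List ℕ) :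
    weight a x (τ ++ [i]) = a (x []) i * weight a (shift i x) τ := by
  induction τ with
  | nil => simp [weight]
  | cons j τ ih => simp only [List.cons_append, weight, ih, shift, mul_assoc]

/-- Adding a newest letter to a word. -/
def consEquiv (n : ℕ) :
    {σ : List ℕ // σ.length = n} × ℕ ≃ {σ : List ℕ // σ.length = n + 1} where
  toFun p := ⟨p.2 :: p.1.1, by simp [p.1.2]⟩
  invFun σ := ⟨⟨σ.1.tail, by simp [σ.2]⟩, σ.1.head (by
    intro h
    have := σ.2
    simp [h] at this)⟩
  left_inv p := by simp
  right_inv σ := by simp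

/-- Adding an oldest letter to a word. -/
def concatEquiv (n : ℕ) :
    ℕ × {σ : List ℕ // σ.length = n} ≃ {σ : List ℕ // σ.length = n + 1} where
  toFun p := ⟨p.2.1 ++ [p.1], by simp [p.2.2]⟩
  invFun σ := ⟨σ.1.getLast (by
    intro h
    have := σ.2
    simp [h] at this), ⟨σ.1.dropLast, by simp [σ.2]⟩⟩
  left_inv p := by simp
  right_inv σ := Subtype.ext (List.dropLast_append_getLast _)

lemma mass_zero (x : List ℕ → E) : mass a 0 x = 1 := by
  unfold mass
  rw [tsum_eq_single (⟨[], rfl⟩ : {σ : List ℕ // σ.length = 0})]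
  · rfl
  · rintro ⟨σ, hσ⟩ h
    exact absurd (Subtype.ext (List.length_eq_zero_iff.1 hσ)) h

/-- Splitting at the last generation: the new labels are independent of the past, which is the form
the martingale property needs. -/
lemma mass_succ (n : ℕ) (x : List ℕ → E) :
    mass a (n + 1) x =
      ∑' σ : {σ : List ℕ // σ.length = n}, weight a x σ * ∑' i, a (x σ) i := by
  unfold mass
  rw [← (consEquiv n).tsum_eq, ENNReal.tsum_prod']
  simp_rw [← ENNReal.tsum_mul_left]
  rfl

/-- Splitting at the root: independent subtrees appear, which is the form the fixed-point equation
and the spine recursion need. -/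
lemma mass_succ_root (n : ℕ) (x : List ℕ → E) :
    mass a (n + 1) x = ∑' i, a (x []) i * mass a n (shift i x) := by
  unfold mass
  rw [← (concatEquiv n).tsum_eq, ENNReal.tsum_prod']
  simp_rw [← ENNReal.tsum_mul_left, ← weight_append]
  rfl

variable {a} [MeasurableSpace E]

lemma measurable_weight (ha : ∀ i, Measurable fun t => a t i) (σ : List ℕ) :
    Measurable fun x => weight a x σ := by
  induction σ with
  | nil => simp [weight]
  | cons i σ ih =>
    simp only [weight]
    exact ih.mul ((ha i).comp (measurable_pi_apply σ))

lemma measurable_mass (ha : ∀ i, Measurable fun t => a t i) (n : ℕ) :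
    Measurable fun x => mass a n x :=
  Measurable.tsum fun σ => measurable_weight ha σ.1

lemma measurable_limitMass (ha : ∀ i, Measurable fun t => a t i) :
    Measurable (limitMass a) :=
  Measurable.limsup fun n => measurable_mass ha n

variable (ν : Measure E) [IsProbabilityMeasure ν]

/-- The law of a tree of independent labels with common law `ν`. -/
noncomputable abbrev treeLaw : Measure (List ℕ → E) := Measure.infinitePi fun _ => ν

lemma lintegral_treeLaw {f : E × (ℕ → List ℕ → E) → ℝ≥0∞} (hf : Measurable f) :
    ∫⁻ x, f (x [], fun i => shift i x) ∂(treeLaw ν) =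
      ∫⁻ t, ∫⁻ y, f (t, y) ∂(Measure.infinitePi fun _ => treeLaw ν) ∂ν := by
  rw [(measurePreserving_root_split ν).lintegral_comp hf, lintegral_prod _ hf.aemeasurable]

lemma lintegral_eval {X : Type*} [MeasurableSpace X] (μ : Measure X) [IsProbabilityMeasure μ]
    (i : ℕ) {f : X → ℝ≥0∞} (hf : Measurable f) :
    ∫⁻ y, f (y i) ∂(Measure.infinitePi fun _ : ℕ => μ) = ∫⁻ x, f x ∂μ :=
  (measurePreserving_eval_infinitePi (fun _ : ℕ => μ) i).lintegral_comp hf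

variable {ν}

lemma lintegral_mass (ha : ∀ i, Measurable fun t => a t i) (h1 : ∫⁻ t, ∑' i, a t i ∂ν = 1)
    (n : ℕ) : ∫⁻ x, mass a n x ∂(treeLaw ν) = 1 := by
  induction n with
  | zero => simp [mass_zero]
  | succ n ih =>
    simp_rw [mass_succ_root]
    have hm : ∀ i, Measurable
        fun p : E × (ℕ → List ℕ → E) => a p.1 i * mass a n (p.2 i) := fun i =>
      ((ha i).comp measurable_fst).mul ((measurable_mass ha n).comp (by fun_prop))
    rw [lintegral_treeLaw ν (f := fun p => ∑' i, a p.1 i * mass a n (p.2 i))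
      (Measurable.tsum hm)]
    have : ∀ t, ∫⁻ y, ∑' i, a t i * mass a n (y i) ∂(Measure.infinitePi fun _ => treeLaw ν) =
        ∑' i, a t i := by
      intro t
      refine (lintegral_tsum fun i =>
        ((hm i).comp (measurable_prodMk_left (x := t))).aemeasurable).trans ?_
      congr 1 with i
      have hmi : Measurable fun y : ℕ → List ℕ → E => mass a n (y i) :=
        (measurable_mass ha n).comp (measurable_pi_apply i)
      simp only [Function.comp_apply]
      rw [lintegral_const_mul _ hmi,
        lintegral_eval (treeLaw ν) i (measurable_mass ha n), ih, mul_one]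
    simp_rw [this, h1]

lemma ae_mass_lt_top (ha : ∀ i, Measurable fun t => a t i) (h1 : ∫⁻ t, ∑' i, a t i ∂ν = 1) :
    ∀ᵐ x ∂(treeLaw ν), ∀ n, mass a n x < ∞ := by
  rw [ae_all_iff]
  intro n
  refine ae_lt_top (measurable_mass ha n) ?_
  simp [lintegral_mass ha h1]

variable (E) in
/-- The information carried by the labels of the generations before `n`. -/
def generationFiltration : Filtration ℕ (inferInstance : MeasurableSpace (List ℕ → E)) where
  seq n := ⨆ σ ∈ {σ : List ℕ | σ.length < n}, MeasurableSpace.comap (fun x => x σ) inferInstance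
  mono' _ _ hnm := biSup_mono fun _ hσ => lt_of_lt_of_le hσ hnm
  le' _ := iSup₂_le fun σ _ => (measurable_pi_apply σ).comap_le

lemma measurable_weight_generationFiltration (ha : ∀ i, Measurable fun t => a t i)
    (σ : List ℕ) (n : ℕ) (hσ : σ.length ≤ n) :
    Measurable[generationFiltration E n] fun x => weight a x σ := by
  induction σ with
  | nil => exact measurable_const
  | cons i σ ih =>
    simp only [weight]
    refine Measurable.mul (ih (Nat.le_of_succ_le hσ)) ((ha i).comp ?_)
    rw [measurable_iff_comap_le]
    exact le_iSup₂_of_le σ (show σ.length < n from hσ) le_rfl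

lemma measurable_mass_generationFiltration (ha : ∀ i, Measurable fun t => a t i) (n : ℕ) :
    Measurable[generationFiltration E n] fun x => mass a n x :=
  measurable_ennreal_tsum fun σ => measurable_weight_generationFiltration ha σ.1 n σ.2.le

/-- A word of length `n` has a label independent of all labels of shorter words, and the sum of the
weights in that label has mean 1. -/
lemma setLIntegral_mass_succ (ha : ∀ i, Measurable fun t => a t i)
    (h1 : ∫⁻ t, ∑' i, a t i ∂ν = 1) (n : ℕ) {s : Set (List ℕ → E)}
    (hs : MeasurableSet[generationFiltration E n] s) :
    ∫⁻ x in s, mass a (n + 1) x ∂(treeLaw ν) = ∫⁻ x in s, mass a n x ∂(treeLaw ν) := by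
  have hs' := (generationFiltration E).le n s hs
  have hsum : Measurable fun t => ∑' i, a t i := Measurable.tsum ha
  simp_rw [mass_succ]
  unfold mass
  refine (lintegral_tsum fun σ : {σ : List ℕ // σ.length = n} => ((measurable_weight ha σ.1).mul
    (hsum.comp (measurable_pi_apply σ.1))).aemeasurable).trans (Eq.trans ?_
    (lintegral_tsum fun σ : {σ : List ℕ // σ.length = n} =>
      (measurable_weight ha σ.1).aemeasurable).symm)
  congr 1 with σ
  rw [← lintegral_indicator hs', ← lintegral_indicator hs']
  have hind : Indep (generationFiltration E n)
      (MeasurableSpace.comap (fun x : List ℕ → E => x σ) inferInstance) (treeLaw ν) := by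
    have hI : iIndepFun (fun (τ : List ℕ) (x : List ℕ → E) => x τ) (treeLaw ν) :=
      iIndepFun_infinitePi (X := fun _ t => t) (fun _ => measurable_id)
    have := indep_iSup_of_disjoint (S := {τ : List ℕ | τ.length < n}) (T := {σ.1})
      (fun τ => (measurable_pi_apply τ).comap_le) hI.iIndep (by
        simp [σ.2])
    simpa [generationFiltration] using this
  have hmul := lintegral_mul_eq_lintegral_mul_lintegral_of_independent_measurableSpace
    (μ := treeLaw ν) (f := s.indicator fun x => weight a x σ) (g := fun x => ∑' i, a (x σ) i)
    ((generationFiltration E).le n) (measurable_pi_apply σ.1).comap_le hind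
    ((measurable_weight_generationFiltration ha σ.1 n σ.2.le).indicator hs)
    (hsum.comp (comap_measurable _))
  have hσ : ∫⁻ x, ∑' i, a (x σ) i ∂(treeLaw ν) = 1 := by
    rw [(measurePreserving_eval_infinitePi (fun _ : List ℕ => ν) σ.1).lintegral_comp hsum, h1]
  rw [hσ, mul_one] at hmul
  rw [← hmul]
  congr 1 with x
  by_cases hx : x ∈ s <;> simp [hx]

/-- The total weights of the generations form a martingale. -/
lemma martingale_mass (ha : ∀ i, Measurable fun t => a t i)
    (h1 : ∫⁻ t, ∑' i, a t i ∂ν = 1) :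
    Martingale (fun n x => (mass a n x).toReal) (generationFiltration E) (treeLaw ν) := by
  refine martingale_of_setIntegral_eq_succ ?_ ?_ ?_
  · exact fun n =>
      ((measurable_mass_generationFiltration ha n).ennreal_toReal).stronglyMeasurable
  · refine fun n => integrable_toReal_of_lintegral_ne_top (measurable_mass ha n).aemeasurable ?_
    simp [lintegral_mass ha h1]
  · intro n s hs
    have hfin := ae_mass_lt_top ha h1
    rw [integral_toReal (measurable_mass ha n).aemeasurable
        (ae_restrict_of_ae (hfin.mono fun x hx => hx n)),
      integral_toReal (measurable_mass ha (n + 1)).aemeasurable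
        (ae_restrict_of_ae (hfin.mono fun x hx => hx (n + 1))), setLIntegral_mass_succ ha h1 n hs]

/-- Doob's theorem applies because a nonnegative martingale of mean 1 is bounded in L¹. -/
lemma ae_tendsto_limitMass (ha : ∀ i, Measurable fun t => a t i)
    (h1 : ∫⁻ t, ∑' i, a t i ∂ν = 1) :
    ∀ᵐ x ∂(treeLaw ν), limitMass a x < ∞ ∧
      Tendsto (fun n => mass a n x) atTop (𝓝 (limitMass a x)) := by
  have hb : ∀ n, eLpNorm (fun x => (mass a n x).toReal) 1 (treeLaw ν) ≤ (1 : NNReal) := by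
    intro n
    rw [eLpNorm_one_eq_lintegral_enorm, ENNReal.coe_one, ← lintegral_mass ha h1 n]
    refine lintegral_mono fun x => ?_
    rw [Real.enorm_of_nonneg ENNReal.toReal_nonneg]
    exact ENNReal.ofReal_toReal_le
  filter_upwards [(martingale_mass ha h1).submartingale.exists_ae_tendsto_of_bdd hb,
    ae_mass_lt_top ha h1] with x ⟨c, hc⟩ hx
  have h2 : Tendsto (fun n => mass a n x) atTop (𝓝 (ENNReal.ofReal c)) := by
    refine (ENNReal.tendsto_ofReal hc).congr fun n => ?_
    exact ENNReal.ofReal_toReal (hx n).ne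
  have h3 : limitMass a x = ENNReal.ofReal c := h2.limsup_eq
  rw [h3]
  exact ⟨ENNReal.ofReal_lt_top, h2⟩

end Mass

/-! ### The fixed-point equation for the limit. -/

section FixedPoint

variable {E : Type*} {a : E → ℕ → ℝ≥0∞} [MeasurableSpace E]
  {ν : Measure E} [IsProbabilityMeasure ν]

variable (ν) in
/-- The law of the sequence of the subtrees of the children of the root. -/
noncomputable abbrev forestLaw : Measure (ℕ → List ℕ → E) :=
  Measure.infinitePi fun _ => treeLaw ν

lemma lintegral_limitMass_le_one (ha : ∀ i, Measurable fun t => a t i)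
    (h1 : ∫⁻ t, ∑' i, a t i ∂ν = 1) : ∫⁻ x, limitMass a x ∂(treeLaw ν) ≤ 1 := by
  calc ∫⁻ x, limitMass a x ∂(treeLaw ν)
      = ∫⁻ x, liminf (fun n => mass a n x) atTop ∂(treeLaw ν) := by
        refine lintegral_congr_ae ?_
        filter_upwards [ae_tendsto_limitMass ha h1] with x hx
        exact hx.2.liminf_eq.symm
    _ ≤ liminf (fun n => ∫⁻ x, mass a n x ∂(treeLaw ν)) atTop :=
        lintegral_liminf_le fun n => measurable_mass ha n
    _ = 1 := by simp [lintegral_mass ha h1]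

lemma lintegral_tsum_mul_eval {G : (List ℕ → E) → ℝ≥0∞} (hG : Measurable G) (w : ℕ → ℝ≥0∞) :
    ∫⁻ y, ∑' i, w i * G (y i) ∂(forestLaw ν) = (∑' i, w i) * ∫⁻ x, G x ∂(treeLaw ν) := by
  have hGi : ∀ i : ℕ, Measurable fun y : ℕ → List ℕ → E => G (y i) :=
    fun i => hG.comp (measurable_pi_apply i)
  rw [lintegral_tsum fun i => ((hGi i).const_mul _).aemeasurable, ← ENNReal.tsum_mul_right]
  congr 1 with i
  rw [lintegral_const_mul _ (hGi i), lintegral_eval (treeLaw ν) i hG]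

variable (a) in
/-- The sum of the limits of the subtrees of the children of the root, weighted by a root label. -/
noncomputable def branchSum (p : E × (ℕ → List ℕ → E)) : ℝ≥0∞ :=
  ∑' i, a p.1 i * limitMass a (p.2 i)

lemma measurable_branchSum (ha : ∀ i, Measurable fun t => a t i) : Measurable (branchSum a) :=
  Measurable.tsum fun i => ((ha i).comp measurable_fst).mul
    ((measurable_limitMass ha).comp ((measurable_pi_apply i).comp measurable_snd))

lemma measurePreserving_shift (i : ℕ) :
    MeasurePreserving (shift i) (treeLaw ν) (treeLaw ν) :=
  measurePreserving_infinitePi_comp ν (e := fun τ => τ ++ [i])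
    (List.append_left_injective [i])

/-- Passing to the limit in finite partial sums gives only one inequality. Since the weights have
total mean 1, both sides have the same integral, which is finite by Fatou, so the inequality is an
equality almost everywhere. -/
lemma ae_limitMass_eq (ha : ∀ i, Measurable fun t => a t i) (hfin : ∀ t i, a t i ≠ ∞)
    (h1 : ∫⁻ t, ∑' i, a t i ∂ν = 1) :
    ∀ᵐ x ∂(treeLaw ν), limitMass a x = branchSum a (x [], fun i => shift i x) := by
  have hle : ∀ᵐ x ∂(treeLaw ν), branchSum a (x [], fun i => shift i x) ≤ limitMass a x := by
    have hs : ∀ᵐ x ∂(treeLaw ν), ∀ i,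
        Tendsto (fun n => mass a n (shift i x)) atTop (𝓝 (limitMass a (shift i x))) := by
      rw [ae_all_iff]
      intro i
      exact (measurePreserving_shift i).quasiMeasurePreserving.ae
        ((ae_tendsto_limitMass ha h1).mono fun x hx => hx.2)
    filter_upwards [ae_tendsto_limitMass ha h1, hs] with x hx hs
    unfold branchSum
    rw [ENNReal.tsum_eq_iSup_sum]
    refine iSup_le fun F => ?_
    have h2 : Tendsto (fun n => ∑ i ∈ F, a (x []) i * mass a n (shift i x)) atTop
        (𝓝 (∑ i ∈ F, a (x []) i * limitMass a (shift i x))) :=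
      tendsto_finsetSum _ fun i _ => ENNReal.Tendsto.const_mul (hs i) (Or.inr (hfin _ _))
    refine le_of_tendsto_of_tendsto' h2 ((tendsto_add_atTop_iff_nat 1).2 hx.2) fun n => ?_
    rw [mass_succ_root]
    exact ENNReal.sum_le_tsum F
  have hmeas : Measurable fun x : List ℕ → E => branchSum a (x [], fun i => shift i x) :=
    (measurable_branchSum ha).comp (measurePreserving_root_split ν).measurable
  have hint : ∫⁻ x, branchSum a (x [], fun i => shift i x) ∂(treeLaw ν) =
      ∫⁻ x, limitMass a x ∂(treeLaw ν) := by
    rw [lintegral_treeLaw ν (measurable_branchSum ha)]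
    simp only [branchSum]
    simp_rw [lintegral_tsum_mul_eval (measurable_limitMass ha)]
    rw [lintegral_mul_const _ (Measurable.tsum ha), h1, one_mul]
  have := ae_eq_of_ae_le_of_lintegral_le hle
    (by
      rw [hint]
      exact ((lintegral_limitMass_le_one ha h1).trans_lt ENNReal.one_lt_top).ne)
    (measurable_limitMass ha).aemeasurable hint.ge
  exact this.mono fun x hx => hx.symm

lemma lintegral_comp_limitMass (ha : ∀ i, Measurable fun t => a t i) (hfin : ∀ t i, a t i ≠ ∞)
    (h1 : ∫⁻ t, ∑' i, a t i ∂ν = 1) {f : ℝ≥0∞ → ℝ≥0∞} (hf : Measurable f) :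
    ∫⁻ x, f (limitMass a x) ∂(treeLaw ν) =
      ∫⁻ t, ∫⁻ y, f (branchSum a (t, y)) ∂(forestLaw ν) ∂ν := by
  refine Eq.trans ?_ (lintegral_treeLaw ν (hf.comp (measurable_branchSum ha)))
  exact lintegral_congr_ae ((ae_limitMass_eq ha hfin h1).mono fun x hx => by
    simp only [Function.comp_apply, hx])

end FixedPoint

/-! ### Extinction and fixed points of the generating function. -/

section Extinction

variable {E : Type*} {a : E → ℕ → ℝ≥0∞}

variable (a) in
/-- The event that all weights of some generation vanish. -/
def extinctionSet : Set (List ℕ → E) := {x | ∃ n, mass a n x = 0}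

lemma mass_eq_zero_mono (x : List ℕ → E) : Monotone fun n => mass a n x = 0 := by
  refine monotone_nat_of_le_succ fun n h => ?_
  rw [mass_succ]
  have h' := ENNReal.tsum_eq_zero.1 h
  simp [h']

open Classical in
variable (a) in
/-- The number of children with a nonzero weight. -/
noncomputable def childCount (t : E) : ℝ≥0∞ := ∑' i, if a t i = 0 then 0 else 1

lemma childCount_eq_encard (t : E) : childCount a t = ({i | a t i ≠ 0}.encard : ℝ≥0∞) := by
  classical
  rw [← ENNReal.tsum_set_one, tsum_subtype {i | a t i ≠ 0} (fun _ => (1 : ℝ≥0∞)), childCount]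
  congr 1 with i
  by_cases h : a t i = 0 <;> simp [h]

/-- The term `r ^ k` of a probability generating function, for `0 ≤ r < 1` and `k ∈ [0, ∞]`. -/
noncomputable def pgfTerm (r : ℝ) (k : ℝ≥0∞) : ℝ := if k = ∞ then 0 else r ^ k.toReal

lemma pgfTerm_top (r : ℝ) : pgfTerm r ∞ = 0 := if_pos rfl

lemma pgfTerm_natCast (r : ℝ) (k : ℕ) : pgfTerm r k = r ^ k := by
  simp [pgfTerm]

lemma measurable_pgfTerm (r : ℝ) : Measurable (pgfTerm r) :=
  Measurable.ite (measurableSet_singleton _) measurable_const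
    (measurable_const.pow ENNReal.measurable_toReal)

lemma pgfTerm_nonneg {r : ℝ} (hr : 0 ≤ r) (k : ℝ≥0∞) : 0 ≤ pgfTerm r k := by
  unfold pgfTerm
  split_ifs
  exacts [le_rfl, Real.rpow_nonneg hr _]

lemma pgfTerm_le_one {r : ℝ} (hr : 0 ≤ r) (hr1 : r ≤ 1) (k : ℝ≥0∞) : pgfTerm r k ≤ 1 := by
  unfold pgfTerm
  split_ifs
  exacts [zero_le_one, Real.rpow_le_one hr hr1 ENNReal.toReal_nonneg]

lemma childCount_cases (t : E) :
    (childCount a t = ∞ ∧ {i | a t i ≠ 0}.Infinite) ∨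
      ∃ F : Finset ℕ, childCount a t = F.card ∧ {i | a t i ≠ 0} = F := by
  rw [childCount_eq_encard]
  by_cases h : {i | a t i ≠ 0}.Finite
  · refine Or.inr ⟨h.toFinset, ?_, by simp⟩
    rw [h.encard_eq_coe_toFinset_card]
    simp
  · exact Or.inl ⟨by rw [Set.Infinite.encard_eq h]; simp, h⟩

/-- In 1 - r^j = (1 - r)(1 + r + ⋯ + r^(j-1)) with j ≤ K each summand is at least r^K. The slope of
this linear bound approaches the truncated count as r → 1, which replaces a derivative of the
generating function at 1. -/
lemma le_one_sub_pgfTerm {r : ℝ} (hr : 0 ≤ r) (hr1 : r ≤ 1) (K : ℕ) (t : E) :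
    (1 - r) * r ^ K * (min (childCount a t) K).toReal ≤ 1 - pgfTerm r (childCount a t) := by
  have key : ∀ j ≤ K, (1 - r) * r ^ K * j ≤ 1 - r ^ j := by
    intro j hj
    have hgeom := mul_neg_geom_sum r j
    have hle : (j : ℝ) * r ^ K ≤ ∑ i ∈ Finset.range j, r ^ i := by
      calc (j : ℝ) * r ^ K = ∑ i ∈ Finset.range j, r ^ K := by simp
        _ ≤ _ := Finset.sum_le_sum fun i hi =>
          pow_le_pow_of_le_one hr hr1 ((Finset.mem_range.1 hi).le.trans hj)
    calc (1 - r) * r ^ K * j = (1 - r) * (j * r ^ K) := by ring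
      _ ≤ (1 - r) * ∑ i ∈ Finset.range j, r ^ i :=
        mul_le_mul_of_nonneg_left hle (sub_nonneg.2 hr1)
      _ = 1 - r ^ j := hgeom
  rcases childCount_cases (a := a) t with ⟨h, -⟩ | ⟨F, h, -⟩
  · rw [h, pgfTerm_top, min_eq_right le_top, ENNReal.toReal_natCast]
    exact (key K le_rfl).trans (by linarith [pow_nonneg hr K])
  · have hmin : min (F.card : ℝ≥0∞) K = (min F.card K : ℕ) :=
      ((Nat.mono_cast (α := ℝ≥0∞)).map_min).symm
    rw [h, pgfTerm_natCast, hmin, ENNReal.toReal_natCast]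
    refine (key _ (min_le_right _ _)).trans ?_
    have := pow_le_pow_of_le_one hr hr1 (min_le_left F.card K)
    linarith

/-- A chord of r ↦ r^k from q to 1. Its right end is given the value 1 even for k = ∞, where the
left side is 0. -/
lemma pgfTerm_convex {q s lam : ℝ} (hq : 0 ≤ q) (hlam : 0 ≤ lam) (hlam1 : lam ≤ 1)
    (hs : s = lam * q + (1 - lam)) (t : E) :
    pgfTerm s (childCount a t) ≤ lam * pgfTerm q (childCount a t) + (1 - lam) := by
  rcases childCount_cases (a := a) t with ⟨h, -⟩ | ⟨F, h, -⟩
  · simp [h, pgfTerm_top, hlam1]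
  · rw [h, pgfTerm_natCast, pgfTerm_natCast, hs]
    have := (convexOn_pow F.card).2 (x := q) (y := 1) hq (Set.mem_Ici.2 zero_le_one) hlam
      (sub_nonneg.2 hlam1) (by ring)
    simpa using this

/-- The power is strictly convex once the exponent is at least 2; for exponent ∞ the chord is
positive while the term is 0. -/
lemma childCount_le_one_of_pgfTerm_eq {q s lam : ℝ} (hq : 0 ≤ q) (hq1 : q < 1) (hlam : 0 < lam)
    (hlam1 : lam < 1) (hs : s = lam * q + (1 - lam)) {t : E}
    (h : pgfTerm s (childCount a t) = lam * pgfTerm q (childCount a t) + (1 - lam)) :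
    childCount a t ≤ 1 := by
  rcases childCount_cases (a := a) t with ⟨h', -⟩ | ⟨F, h', -⟩
  · rw [h', pgfTerm_top, pgfTerm_top] at h
    linarith
  · rw [h', pgfTerm_natCast, pgfTerm_natCast] at h
    by_contra! hc
    rw [h'] at hc
    have hc' : 2 ≤ F.card := by exact_mod_cast hc
    have := (strictConvexOn_pow hc').2 (x := q) (y := 1) hq (Set.mem_Ici.2 zero_le_one) hq1.ne hlam
      (sub_pos.2 hlam1) (by ring)
    simp only [smul_eq_mul, mul_one, one_pow, ← hs] at this
    linarith

variable [MeasurableSpace E] {ν : Measure E} [IsProbabilityMeasure ν]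

lemma measurable_childCount (ha : ∀ i, Measurable fun t => a t i) : Measurable (childCount a) := by
  classical
  exact Measurable.tsum fun i => Measurable.ite (ha i (measurableSet_singleton 0))
    measurable_const measurable_const

/-- The subtrees are independent. With infinitely many relevant children the probability is below
every power of a number less than 1, matching the convention at ∞. -/
lemma forestLaw_real_forall_mem {B : Set (List ℕ → E)} (hB : MeasurableSet B)
    (hB1 : treeLaw ν B < 1) (t : E) :
    (forestLaw ν {y | ∀ i, a t i ≠ 0 → y i ∈ B}).toReal =
      pgfTerm (treeLaw ν B).toReal (childCount a t) := by
  have hfin : ∀ F : Finset ℕ, forestLaw ν {y | ∀ i ∈ F, y i ∈ B} = treeLaw ν B ^ F.card := by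
    intro F
    have := Measure.infinitePi_pi (fun _ : ℕ => treeLaw ν) (s := F) (t := fun _ => B)
      (fun _ _ => hB)
    rw [Finset.prod_const] at this
    exact this
  rcases childCount_cases (a := a) t with ⟨h, hS⟩ | ⟨F, h, hS⟩
  · rw [h, pgfTerm_top]
    have : forestLaw ν {y | ∀ i, a t i ≠ 0 → y i ∈ B} = 0 := by
      refine le_antisymm (ge_of_tendsto' (ENNReal.tendsto_pow_atTop_nhds_zero_of_lt_one hB1)
        fun n => ?_) zero_le
      obtain ⟨F, hF, hc⟩ := hS.exists_subset_card_eq n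
      rw [← hc, ← hfin F]
      exact measure_mono fun y hy i hi => hy i (hF hi)
    simp [this]
  · rw [h, pgfTerm_natCast, ← ENNReal.toReal_pow, ← hfin F]
    congr 3 with y
    refine forall_congr' fun i => ?_
    have : a t i ≠ 0 ↔ i ∈ F := by
      rw [← Finset.mem_coe, ← hS]
      rfl
    rw [this]

/-- Serves two purposes: the recursion for the vanishing of successive generations, and, with `B =
C`, the fixed-point equation for the vanishing of the limit. -/
lemma treeLaw_real_eq_integral_pgfTerm (ha : ∀ i, Measurable fun t => a t i)
    {B C : Set (List ℕ → E)} (hB : MeasurableSet B) (hB1 : treeLaw ν B < 1)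
    (hC : ∀ᵐ x ∂(treeLaw ν), x ∈ C ↔ ∀ i, a (x []) i ≠ 0 → shift i x ∈ B) :
    (treeLaw ν C).toReal = ∫ t, pgfTerm (treeLaw ν B).toReal (childCount a t) ∂ν := by
  have hD : MeasurableSet {p : E × (ℕ → List ℕ → E) | ∀ i, a p.1 i ≠ 0 → p.2 i ∈ B} := by
    have : {p : E × (ℕ → List ℕ → E) | ∀ i, a p.1 i ≠ 0 → p.2 i ∈ B} =
        ⋂ i, ((fun p : E × (ℕ → List ℕ → E) => a p.1 i) ⁻¹' {0} ∪
          (fun p : E × (ℕ → List ℕ → E) => p.2 i) ⁻¹' B) := by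
      ext p
      simp [or_iff_not_imp_left]
    rw [this]
    exact MeasurableSet.iInter fun i =>
      (((ha i).comp measurable_fst) (measurableSet_singleton 0)).union
        (((measurable_pi_apply i).comp measurable_snd) hB)
  have h : treeLaw ν C = ∫⁻ t, forestLaw ν {y | ∀ i, a t i ≠ 0 → y i ∈ B} ∂ν := by
    rw [measure_congr (Filter.eventuallyEq_set.2 hC)]
    have := (measurePreserving_root_split ν).measure_preimage hD.nullMeasurableSet
    rw [Measure.prod_apply hD] at this
    exact this
  rw [h]
  refine (integral_toReal (measurable_measure_prodMk_left hD).aemeasurable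
    (ae_of_all _ fun t => measure_lt_top _ _)).symm.trans ?_
  exact integral_congr_ae (ae_of_all _ fun t => forestLaw_real_forall_mem hB hB1 t)

lemma integrable_pgfTerm (ha : ∀ i, Measurable fun t => a t i) {r : ℝ} (hr : 0 ≤ r)
    (hr1 : r ≤ 1) : Integrable (fun t => pgfTerm r (childCount a t)) ν :=
  Integrable.of_bound ((measurable_pgfTerm r).comp (measurable_childCount ha)).aestronglyMeasurable
    1 (ae_of_all _ fun t => by
      rw [Real.norm_of_nonneg (pgfTerm_nonneg hr _)]
      exact pgfTerm_le_one hr hr1 _)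

/-- A supercritical probability generating function has at most one fixed point below `1`. -/
lemma pgf_fixedPoint_unique (ha : ∀ i, Measurable fun t => a t i)
    (hN : 1 < ∫⁻ t, childCount a t ∂ν) {q s : ℝ} (hq0 : 0 ≤ q) (hqs : q ≤ s) (hs1 : s < 1)
    (hq : q = ∫ t, pgfTerm q (childCount a t) ∂ν)
    (hs : s = ∫ t, pgfTerm s (childCount a t) ∂ν) : q = s := by
  by_contra hne
  have hlt : q < s := lt_of_le_of_ne hqs hne
  have hq1 : 0 < 1 - q := by linarith
  set lam := (1 - s) / (1 - q) with hlam
  have hlam0 : 0 < lam := div_pos (by linarith) hq1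
  have hlam1 : lam < 1 := (div_lt_one hq1).2 (by linarith)
  have hslam : s = lam * q + (1 - lam) := by
    rw [hlam]
    field_simp
    ring
  have hiq := integrable_pgfTerm (ν := ν) ha hq0 (by linarith : q ≤ 1)
  have his := integrable_pgfTerm (ν := ν) ha (hq0.trans hqs) hs1.le
  have hir : Integrable (fun t => lam * pgfTerm q (childCount a t) + (1 - lam)) ν :=
    (hiq.const_mul lam).add (integrable_const _)
  have heq : ∀ᵐ t ∂ν, pgfTerm s (childCount a t) =
      lam * pgfTerm q (childCount a t) + (1 - lam) := by
    -- Both `q` and `s` are fixed points, so the two sides of the convexity inequality have equal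
    -- integrals and hence agree almost everywhere.
    refine (integral_eq_iff_of_ae_le his hir
      (ae_of_all _ fun t => pgfTerm_convex hq0 hlam0.le hlam1.le hslam t)).1 ?_
    rw [integral_add (hiq.const_mul lam) (integrable_const _), integral_const_mul, ← hq, ← hs]
    simpa using hslam
  have : ∫⁻ t, childCount a t ∂ν ≤ 1 := by
    calc ∫⁻ t, childCount a t ∂ν ≤ ∫⁻ _, 1 ∂ν := lintegral_mono_ae (heq.mono fun t ht =>
          childCount_le_one_of_pgfTerm_eq hq0 (by linarith) hlam0 hlam1 hslam ht)
      _ = 1 := by simp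
  exact absurd hN this.not_gt

lemma treeLaw_mass_eq_zero_lt_one (ha : ∀ i, Measurable fun t => a t i)
    (h1 : ∫⁻ t, ∑' i, a t i ∂ν = 1) (n : ℕ) : treeLaw ν {x | mass a n x = 0} < 1 := by
  refine lt_of_le_of_ne prob_le_one fun h => ?_
  have h0 : ∀ᵐ x ∂(treeLaw ν), mass a n x = 0 :=
    (prob_compl_eq_zero_iff (measurable_mass ha n (measurableSet_singleton 0))).2 h
  have := lintegral_mass ha h1 n
  rw [lintegral_congr_ae h0] at this
  simp at this

lemma treeLaw_mass_succ_eq_zero (ha : ∀ i, Measurable fun t => a t i)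
    (h1 : ∫⁻ t, ∑' i, a t i ∂ν = 1) (n : ℕ) :
    (treeLaw ν {x | mass a (n + 1) x = 0}).toReal =
      ∫ t, pgfTerm (treeLaw ν {x | mass a n x = 0}).toReal (childCount a t) ∂ν := by
  refine treeLaw_real_eq_integral_pgfTerm ha (measurable_mass ha n (measurableSet_singleton 0))
    (treeLaw_mass_eq_zero_lt_one ha h1 n) (ae_of_all _ fun x => ?_)
  simp only [Set.mem_ofPred_eq, mass_succ_root, ENNReal.tsum_eq_zero, mul_eq_zero,
    or_iff_not_imp_left, ne_eq]

lemma tendsto_treeLaw_mass_eq_zero :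
    Tendsto (fun n => (treeLaw ν {x | mass a n x = 0}).toReal) atTop
      (𝓝 (treeLaw ν (extinctionSet a)).toReal) := by
  have hmono : Monotone fun n => {x : List ℕ → E | mass a n x = 0} :=
    fun n m hnm x hx => mass_eq_zero_mono x hnm hx
  have : extinctionSet a = ⋃ n, {x : List ℕ → E | mass a n x = 0} := by
    ext x
    simp [extinctionSet]
  rw [this]
  exact (ENNReal.tendsto_toReal (measure_ne_top _ _)).comp (tendsto_measure_iUnion_atTop hmono)

/-- A supercritical branching process survives with positive probability. -/
lemma treeLaw_extinctionSet_lt_one (ha : ∀ i, Measurable fun t => a t i)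
    (h1 : ∫⁻ t, ∑' i, a t i ∂ν = 1) (hN : 1 < ∫⁻ t, childCount a t ∂ν) :
    treeLaw ν (extinctionSet a) < 1 := by
  refine lt_of_le_of_ne prob_le_one fun h => ?_
  have hlim := tendsto_treeLaw_mass_eq_zero (a := a) (ν := ν)
  rw [h, ENNReal.toReal_one] at hlim
  set q := fun n => (treeLaw ν {x | mass a n x = 0}).toReal with hq
  have hq0 : ∀ n, 0 ≤ q n := fun n => ENNReal.toReal_nonneg
  have hq1 : ∀ n, q n < 1 := fun n => by
    have := (ENNReal.toReal_lt_toReal (measure_ne_top _ _) ENNReal.one_ne_top).2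
      (treeLaw_mass_eq_zero_lt_one (ν := ν) ha h1 n)
    simpa using this
  have hcm := measurable_childCount ha
  -- The mean number of children may be infinite; truncation makes it finite while keeping it above
  -- 1.
  obtain ⟨K, hK⟩ : ∃ K : ℕ, 1 < ∫⁻ t, min (childCount a t) K ∂ν := by
    have ht : Tendsto (fun K : ℕ => ∫⁻ t, min (childCount a t) K ∂ν) atTop
        (𝓝 (∫⁻ t, childCount a t ∂ν)) := by
      refine lintegral_tendsto_of_tendsto_of_monotone
        (fun K => (hcm.min measurable_const).aemeasurable)
        (ae_of_all _ fun t K L hKL => min_le_min_left _ (by exact_mod_cast hKL))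
        (ae_of_all _ fun t => ?_)
      have : Tendsto (fun K : ℕ => min (childCount a t) K) atTop (𝓝 (min (childCount a t) ∞)) :=
        tendsto_const_nhds.min ENNReal.tendsto_nat_nhds_top
      simpa using this
    exact (ht.eventually_const_lt hN).exists
  have hmin : ∀ t, min (childCount a t) K ≤ K := fun t => min_le_right _ _
  have hcfin : ∫⁻ t, min (childCount a t) K ∂ν ≠ ∞ := by
    refine ((lintegral_mono hmin).trans_lt ?_).ne
    simp
  set c := (∫⁻ t, min (childCount a t) K ∂ν).toReal with hc
  have hc1 : 1 < c := by
    have := (ENNReal.toReal_lt_toReal ENNReal.one_ne_top hcfin).2 hK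
    simpa using this
  have hcint : c = ∫ t, (min (childCount a t) K).toReal ∂ν := by
    rw [hc, integral_toReal (hcm.min measurable_const).aemeasurable
      (ae_of_all _ fun t => (hmin t).trans_lt (ENNReal.natCast_lt_top K))]
  -- If `q n → 1`, the factor `q n ^ K * c` eventually exceeds 1, so the survival probability would
  -- strictly increase from one generation to the next, which is impossible.
  have hstep : ∀ n, (1 - q n) * (q n ^ K * c) ≤ 1 - q (n + 1) := by
    intro n
    have hint := integrable_pgfTerm (ν := ν) ha (hq0 n) (hq1 n).le
    have e1 : q (n + 1) = ∫ t, pgfTerm (q n) (childCount a t) ∂ν :=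
      treeLaw_mass_succ_eq_zero ha h1 n
    have e2 : 1 - q (n + 1) = ∫ t, (1 - pgfTerm (q n) (childCount a t)) ∂ν := by
      rw [integral_sub (integrable_const _) hint, ← e1]
      simp
    rw [e2, ← mul_assoc, hcint, ← integral_const_mul]
    refine integral_mono ?_ ((integrable_const _).sub hint)
      fun t => le_one_sub_pgfTerm (hq0 n) (hq1 n).le K t
    exact (integrable_toReal_of_lintegral_ne_top (hcm.min measurable_const).aemeasurable
      hcfin).const_mul _
  have hev : ∀ᶠ n in atTop, 1 < q n ^ K * c := by
    have : Tendsto (fun n => q n ^ K * c) atTop (𝓝 (1 ^ K * c)) := (hlim.pow K).mul_const c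
    rw [one_pow, one_mul] at this
    exact this.eventually_const_lt hc1
  obtain ⟨n, hn⟩ := hev.exists
  have hmono : q n ≤ q (n + 1) := ENNReal.toReal_mono (measure_ne_top _ _)
    (measure_mono fun x hx => mass_eq_zero_mono x n.le_succ hx)
  have := hstep n
  nlinarith [hq1 n]

/-- If the limit is not almost surely zero, it vanishes exactly with the extinction probability. -/
lemma treeLaw_limitMass_eq_zero (ha : ∀ i, Measurable fun t => a t i) (hfin : ∀ t i, a t i ≠ ∞)
    (h1 : ∫⁻ t, ∑' i, a t i ∂ν = 1) (hN : 1 < ∫⁻ t, childCount a t ∂ν)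
    (h : treeLaw ν {x | limitMass a x = 0} < 1) :
    treeLaw ν {x | limitMass a x = 0} = treeLaw ν (extinctionSet a) := by
  have hs1 : (treeLaw ν {x | limitMass a x = 0}).toReal < 1 := by
    simpa using (ENNReal.toReal_lt_toReal (measure_ne_top _ _) ENNReal.one_ne_top).2 h
  have hle : treeLaw ν (extinctionSet a) ≤ treeLaw ν {x | limitMass a x = 0} := by
    refine measure_mono fun x ⟨n, hn⟩ => ?_
    have : ∀ᶠ m in atTop, mass a m x = 0 :=
      (eventually_ge_atTop n).mono fun m hm => mass_eq_zero_mono x hm hn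
    exact (tendsto_const_nhds.congr' (this.mono fun m hm => hm.symm)).limsup_eq
  have hle' := ENNReal.toReal_mono (measure_ne_top _ _) hle
  have hq : (treeLaw ν (extinctionSet a)).toReal =
      ∫ t, pgfTerm (treeLaw ν (extinctionSet a)).toReal (childCount a t) ∂ν := by
    have hlim := tendsto_treeLaw_mass_eq_zero (a := a) (ν := ν)
    refine tendsto_nhds_unique ((tendsto_add_atTop_iff_nat 1).2 hlim) ?_
    simp_rw [treeLaw_mass_succ_eq_zero ha h1]
    refine tendsto_integral_of_dominated_convergence (fun _ => 1)
      (fun n => ((measurable_pgfTerm _).comp (measurable_childCount ha)).aestronglyMeasurable)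
      (integrable_const _) (fun n => ae_of_all _ fun t => ?_) (ae_of_all _ fun t => ?_)
    · rw [Real.norm_of_nonneg (pgfTerm_nonneg ENNReal.toReal_nonneg _)]
      exact pgfTerm_le_one ENNReal.toReal_nonneg
        (by simpa using ENNReal.toReal_mono ENNReal.one_ne_top prob_le_one) _
    · rcases childCount_cases (a := a) t with ⟨h, -⟩ | ⟨F, h, -⟩
      · simp [h, pgfTerm_top]
      · simp only [h, pgfTerm_natCast]
        exact hlim.pow _
  have hs : (treeLaw ν {x | limitMass a x = 0}).toReal =
      ∫ t, pgfTerm (treeLaw ν {x | limitMass a x = 0}).toReal (childCount a t) ∂ν := by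
    refine treeLaw_real_eq_integral_pgfTerm ha
      (measurable_limitMass ha (measurableSet_singleton 0)) h ?_
    filter_upwards [ae_limitMass_eq ha hfin h1] with x hx
    simp only [hx, branchSum, ENNReal.tsum_eq_zero, mul_eq_zero,
      or_iff_not_imp_left, ne_eq]
  have := pgf_fixedPoint_unique ha hN ENNReal.toReal_nonneg hle' hs1 hq hs
  exact ((ENNReal.toReal_eq_toReal_iff' (measure_ne_top _ _) (measure_ne_top _ _)).1 this).symm

end Extinction

/-! ### Differences of equally distributed variables. -/

section EqualLaw

/-- If `u` and `v` have the same law and the negative part of `u - v` is integrable, then so is its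
positive part, and its integral is no larger. -/
lemma lintegral_ofReal_sub_le_of_map_eq {Z : Type*} [MeasurableSpace Z] {μ : Measure Z}
    [IsFiniteMeasure μ] {u v : Z → ℝ} (hu : Measurable u) (hv : Measurable v)
    (h : μ.map u = μ.map v) :
    ∫⁻ z, ENNReal.ofReal (u z - v z) ∂μ ≤ ∫⁻ z, ENNReal.ofReal (v z - u z) ∂μ := by
  -- Clamping to [-K, K] makes both means finite, hence equal. It is monotone and 1-Lipschitz, so
  -- the negative part of the difference does not grow; Fatou then removes the clamp.
  set c : ℕ → ℝ → ℝ := fun K x => max (-(K : ℝ)) (min x K) with hc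
  have hcm : ∀ K, Measurable (c K) := fun K => measurable_const.max (measurable_id.min measurable_const)
  have hcb : ∀ K x, |c K x| ≤ K := fun K x => by
    have hK : (0 : ℝ) ≤ K := Nat.cast_nonneg K
    exact abs_le.2 ⟨le_max_left _ _, max_le (by linarith) (min_le_right _ _)⟩
  have hint : ∀ K (w : Z → ℝ), Measurable w → Integrable (fun z => c K (w z)) μ := fun K w hw =>
    Integrable.of_bound ((hcm K).comp hw).aestronglyMeasurable K (ae_of_all _ fun z => hcb K (w z))
  have hlip : ∀ K x y, ENNReal.ofReal (c K x - c K y) ≤ ENNReal.ofReal (x - y) := by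
    intro K x y
    rcases le_total x y with hxy | hxy
    · have : c K x ≤ c K y := max_le_max le_rfl (min_le_min hxy le_rfl)
      rw [ENNReal.ofReal_of_nonpos (by linarith)]
      exact zero_le
    · refine ENNReal.ofReal_le_ofReal ?_
      have h1 : min x (K : ℝ) - min y K ≤ x - y := by
        rcases min_choice y (K : ℝ) with h | h <;> rw [h]
        · linarith [min_le_left x (K : ℝ)]
        · linarith [min_le_right x (K : ℝ)]
      have h2 : c K x ≤ c K y + (x - y) := max_le (by
        have : -(K : ℝ) ≤ c K y := le_max_left _ _
        linarith) (by
        have : min y (K : ℝ) ≤ c K y := le_max_right _ _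
        linarith)
      linarith
  have hK : ∀ K, ∫⁻ z, ENNReal.ofReal (c K (u z) - c K (v z)) ∂μ ≤
      ∫⁻ z, ENNReal.ofReal (v z - u z) ∂μ := by
    intro K
    have hD : Integrable (fun z => c K (u z) - c K (v z)) μ := (hint K u hu).sub (hint K v hv)
    have h0 : ∫ z, (c K (u z) - c K (v z)) ∂μ = 0 := by
      rw [integral_sub (hint K u hu) (hint K v hv),
        ← integral_map hu.aemeasurable (hcm K).aestronglyMeasurable,
        ← integral_map hv.aemeasurable (hcm K).aestronglyMeasurable, h, sub_self]
    rw [integral_eq_lintegral_pos_part_sub_lintegral_neg_part hD, sub_eq_zero] at h0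
    rw [(ENNReal.toReal_eq_toReal_iff' hD.lintegral_lt_top.ne hD.neg.lintegral_lt_top.ne).1 h0]
    refine lintegral_mono fun z => ?_
    simp only [Pi.neg_apply, neg_sub]
    exact hlip K _ _
  have hlim : ∀ z, Tendsto (fun K : ℕ => ENNReal.ofReal (c K (u z) - c K (v z))) atTop
      (𝓝 (ENNReal.ofReal (u z - v z))) := by
    intro z
    refine tendsto_const_nhds.congr' ?_
    filter_upwards [eventually_ge_atTop ⌈max |u z| |v z|⌉₊] with K hK
    have hKm : max |u z| |v z| ≤ K := Nat.ceil_le.1 hK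
    have hcK : ∀ x, |x| ≤ max |u z| |v z| → c K x = x := fun x hx => by
      have := abs_le.1 (hx.trans hKm)
      simp only [hc]
      rw [min_eq_left this.2, max_eq_right this.1]
    rw [hcK _ (le_max_left _ _), hcK _ (le_max_right _ _)]
  calc ∫⁻ z, ENNReal.ofReal (u z - v z) ∂μ
      = ∫⁻ z, liminf (fun K : ℕ => ENNReal.ofReal (c K (u z) - c K (v z))) atTop ∂μ :=
        lintegral_congr fun z => (hlim z).liminf_eq.symm
    _ ≤ liminf (fun K : ℕ => ∫⁻ z, ENNReal.ofReal (c K (u z) - c K (v z)) ∂μ) atTop :=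
        lintegral_liminf_le fun K =>
          (((hcm K).comp hu).sub ((hcm K).comp hv)).ennreal_ofReal
    _ ≤ _ := liminf_le_of_le (by isBoundedDefault) fun b hb => by
        obtain ⟨K, hK'⟩ := hb.exists
        exact hK'.trans (hK K)

end EqualLaw

/-! ### The spine and the law tilted by the limit. -/

section Spine

variable {E : Type*} {a : E → ℕ → ℝ≥0∞} [MeasurableSpace E]
  {ν : Measure E}

variable (a ν) in
/-- The size-biased law of a label together with a child chosen according to the weights. -/
noncomputable def spineLaw : Measure (ℕ × E) :=
  (Measure.count.prod ν).withDensity fun z => a z.2 z.1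

variable (a) in
/-- The logarithm of the weight of the chosen child. -/
noncomputable def logWeight (z : ℕ × E) : ℝ := Real.log (a z.2 z.1).toReal

lemma measurable_weight_prod (ha : ∀ i, Measurable fun t => a t i) :
    Measurable fun z : ℕ × E => a z.2 z.1 :=
  measurable_from_prod_countable_right fun i => ha i

lemma measurable_logWeight (ha : ∀ i, Measurable fun t => a t i) : Measurable (logWeight a) :=
  (measurable_weight_prod ha).ennreal_toReal.log

lemma ae_spineLaw_ne_zero (ha : ∀ i, Measurable fun t => a t i) :
    ∀ᵐ z ∂(spineLaw a ν), a z.2 z.1 ≠ 0 := by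
  rw [spineLaw, ae_withDensity_iff (measurable_weight_prod ha)]
  exact ae_of_all _ fun z h => h

variable [IsProbabilityMeasure ν]

/-- The many-to-one formula: a weighted sum over children becomes an expectation over one chosen
child. -/
lemma lintegral_spineLaw (ha : ∀ i, Measurable fun t => a t i) {f : ℕ × E → ℝ≥0∞}
    (hf : Measurable f) :
    ∫⁻ z, f z ∂(spineLaw a ν) = ∫⁻ t, ∑' i, a t i * f (i, t) ∂ν := by
  have hm := measurable_weight_prod ha
  rw [spineLaw, lintegral_withDensity_eq_lintegral_mul _ hm hf,
    lintegral_prod_symm _ (hm.mul hf).aemeasurable]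
  congr 1 with t
  rw [lintegral_count]
  rfl

lemma isProbabilityMeasure_spineLaw (ha : ∀ i, Measurable fun t => a t i)
    (h1 : ∫⁻ t, ∑' i, a t i ∂ν = 1) : IsProbabilityMeasure (spineLaw a ν) := by
  constructor
  rw [← lintegral_one, lintegral_spineLaw ha measurable_const]
  simpa using h1

variable (a ν) in
/-- The joint law of the label of the root, a chosen child of the root, and the subtrees of all
children, biased by the contribution of the chosen child to the limit. -/
noncomputable def tiltedLaw : Measure ((ℕ × E) × (ℕ → List ℕ → E)) :=
  ((spineLaw a ν).prod (forestLaw ν)).withDensity fun z => limitMass a (z.2 z.1.1)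

lemma measurable_limitMass_chosen (ha : ∀ i, Measurable fun t => a t i) :
    Measurable fun z : (ℕ × E) × (ℕ → List ℕ → E) => limitMass a (z.2 z.1.1) := by
  have h : Measurable fun z : ℕ × (ℕ → List ℕ → E) => limitMass a (z.2 z.1) :=
    measurable_from_prod_countable_right fun i => (measurable_limitMass ha).comp (measurable_pi_apply i)
  have h2 : Measurable fun z : (ℕ × E) × (ℕ → List ℕ → E) => (z.1.1, z.2) := by fun_prop
  exact (h.comp h2 :)

lemma lintegral_tiltedLaw (ha : ∀ i, Measurable fun t => a t i)
    (h1 : ∫⁻ t, ∑' i, a t i ∂ν = 1)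
    {f : (ℕ × E) × (ℕ → List ℕ → E) → ℝ≥0∞} (hf : Measurable f) :
    ∫⁻ z, f z ∂(tiltedLaw a ν) =
      ∫⁻ t, ∫⁻ y, ∑' i, a t i * limitMass a (y i) * f ((i, t), y) ∂(forestLaw ν) ∂ν := by
  have := isProbabilityMeasure_spineLaw ha h1
  have hm := measurable_limitMass_chosen (a := a) ha
  have hmf := hm.mul hf
  rw [tiltedLaw, lintegral_withDensity_eq_lintegral_mul _ hm hf,
    lintegral_prod _ hmf.aemeasurable, lintegral_spineLaw ha hmf.lintegral_prod_right']
  congr 1 with t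
  have hmi : ∀ i : ℕ, Measurable fun y : ℕ → List ℕ → E =>
      limitMass a (y i) * f ((i, t), y) := fun i =>
    (hmf.comp (measurable_prodMk_left (x := (i, t))) :)
  simp_rw [mul_assoc]
  rw [lintegral_tsum fun i => ((hmi i).const_mul _).aemeasurable]
  congr 1 with i
  rw [lintegral_const_mul _ (hmi i)]
  rfl

lemma lintegral_tiltedLaw_fst (ha : ∀ i, Measurable fun t => a t i)
    (h1 : ∫⁻ t, ∑' i, a t i ∂ν = 1) {f : ℕ × E → ℝ≥0∞} (hf : Measurable f) :
    ∫⁻ z, f z.1 ∂(tiltedLaw a ν) =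
      (∫⁻ x, limitMass a x ∂(treeLaw ν)) * ∫⁻ z, f z ∂(spineLaw a ν) := by
  have hm : Measurable fun t => ∑' i, a t i * f (i, t) := Measurable.tsum fun i =>
    (ha i).mul (hf.comp (measurable_prodMk_left (x := i)))
  rw [lintegral_tiltedLaw ha h1 (f := fun z => f z.1) (hf.comp measurable_fst), lintegral_spineLaw ha hf, mul_comm,
    ← lintegral_mul_const _ hm]
  congr 1 with t
  rw [← lintegral_tsum_mul_eval (measurable_limitMass ha)]
  congr 1 with y
  congr 1 with i
  ring

lemma map_fst_tiltedLaw (ha : ∀ i, Measurable fun t => a t i) (h1 : ∫⁻ t, ∑' i, a t i ∂ν = 1) :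
    (tiltedLaw a ν).map Prod.fst = (∫⁻ x, limitMass a x ∂(treeLaw ν)) • spineLaw a ν := by
  ext s hs
  have := lintegral_tiltedLaw_fst (ν := ν) ha h1 (measurable_one.indicator hs)
  rw [lintegral_indicator_one hs] at this
  rw [Measure.map_apply measurable_fst hs, Measure.smul_apply, smul_eq_mul, ← this,
    ← lintegral_indicator_one (measurable_fst hs)]
  rfl

/-- Each subtree contributes the same size-biased integral, and the weights sum to 1 in mean. -/
lemma lintegral_tiltedLaw_chosen (ha : ∀ i, Measurable fun t => a t i)
    (h1 : ∫⁻ t, ∑' i, a t i ∂ν = 1) {g : ℝ≥0∞ → ℝ≥0∞} (hg : Measurable g) :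
    ∫⁻ z, g (limitMass a (z.2 z.1.1)) ∂(tiltedLaw a ν) =
      ∫⁻ x, limitMass a x * g (limitMass a x) ∂(treeLaw ν) := by
  have hl := measurable_limitMass ha
  rw [lintegral_tiltedLaw ha h1 (f := fun z => g (limitMass a (z.2 z.1.1)))
    (hg.comp (measurable_limitMass_chosen ha))]
  simp only [mul_assoc]
  simp_rw [lintegral_tsum_mul_eval (G := fun x => limitMass a x * g (limitMass a x))
    (hl.mul (hg.comp hl))]
  rw [lintegral_mul_const _ (Measurable.tsum ha), h1, one_mul]

/-- A function that ignores the choice is biased by the whole sum of a_i W_i, which by the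
fixed-point equation has the law of the limit itself. -/
lemma lintegral_tiltedLaw_branchSum (ha : ∀ i, Measurable fun t => a t i)
    (hfin : ∀ t i, a t i ≠ ∞) (h1 : ∫⁻ t, ∑' i, a t i ∂ν = 1) {g : ℝ≥0∞ → ℝ≥0∞}
    (hg : Measurable g) :
    ∫⁻ z, g (branchSum a (z.1.2, z.2)) ∂(tiltedLaw a ν) =
      ∫⁻ x, limitMass a x * g (limitMass a x) ∂(treeLaw ν) := by
  have hp : Measurable fun z : (ℕ × E) × (ℕ → List ℕ → E) => (z.1.2, z.2) := by fun_prop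
  rw [lintegral_tiltedLaw ha h1 (f := fun z => g (branchSum a (z.1.2, z.2)))
      (hg.comp ((measurable_branchSum ha).comp hp)),
    lintegral_comp_limitMass ha hfin h1 (f := fun w => w * g w) (measurable_id.mul hg)]
  simp only [ENNReal.tsum_mul_right]
  rfl

/-- Both variables have the size-biased law of the limit. This stationarity along the spine drives
both necessity proofs. -/
lemma map_branchSum_tiltedLaw (ha : ∀ i, Measurable fun t => a t i)
    (hfin : ∀ t i, a t i ≠ ∞) (h1 : ∫⁻ t, ∑' i, a t i ∂ν = 1) :
    (tiltedLaw a ν).map (fun z => branchSum a (z.1.2, z.2)) =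
      (tiltedLaw a ν).map fun z => limitMass a (z.2 z.1.1) := by
  have hU : Measurable fun z : (ℕ × E) × (ℕ → List ℕ → E) => branchSum a (z.1.2, z.2) :=
    (measurable_branchSum ha).comp (by fun_prop)
  have hV := measurable_limitMass_chosen (a := a) ha
  ext s hs
  have e1 := lintegral_tiltedLaw_branchSum (ν := ν) ha hfin h1 (measurable_one.indicator hs)
  have e2 := lintegral_tiltedLaw_chosen (ν := ν) ha h1 (measurable_one.indicator hs)
  rw [Measure.map_apply hU hs, Measure.map_apply hV hs, ← lintegral_indicator_one (hU hs),
    ← lintegral_indicator_one (hV hs)]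
  exact e1.trans e2.symm

lemma isFiniteMeasure_tiltedLaw (ha : ∀ i, Measurable fun t => a t i)
    (h1 : ∫⁻ t, ∑' i, a t i ∂ν = 1) : IsFiniteMeasure (tiltedLaw a ν) := by
  constructor
  rw [← lintegral_one, lintegral_tiltedLaw_chosen ha h1 (g := fun _ => 1) measurable_const]
  simpa using (lintegral_limitMass_le_one ha h1).trans_lt ENNReal.one_lt_top

/-- The bias excludes 0 and the limit is a.s. finite, so the real logarithms used later are genuine.
-/
lemma ae_tiltedLaw_chosen (ha : ∀ i, Measurable fun t => a t i)
    (h1 : ∫⁻ t, ∑' i, a t i ∂ν = 1) :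
    ∀ᵐ z ∂(tiltedLaw a ν), limitMass a (z.2 z.1.1) ≠ 0 ∧ limitMass a (z.2 z.1.1) ≠ ∞ := by
  have hV := measurable_limitMass_chosen (a := a) ha
  have hs : MeasurableSet ({0, ∞} : Set ℝ≥0∞) := (Set.toFinite _).measurableSet
  have e := lintegral_tiltedLaw_chosen (ν := ν) ha h1 (measurable_one.indicator hs)
  have e0 : ∫⁻ x, limitMass a x * ({0, ∞} : Set ℝ≥0∞).indicator 1 (limitMass a x) ∂(treeLaw ν) =
      0 := by
    have hm : Measurable fun x => limitMass a x * ({0, ∞} : Set ℝ≥0∞).indicator 1 (limitMass a x) :=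
      (measurable_limitMass ha).mul ((measurable_one.indicator hs).comp (measurable_limitMass ha))
    rw [lintegral_eq_zero_iff hm]
    filter_upwards [ae_tendsto_limitMass ha h1] with x hx
    by_cases h : limitMass a x = 0 <;> simp [h, hx.1.ne]
  have hm : Measurable fun z : (ℕ × E) × (ℕ → List ℕ → E) =>
      ({0, ∞} : Set ℝ≥0∞).indicator (1 : ℝ≥0∞ → ℝ≥0∞) (limitMass a (z.2 z.1.1)) :=
    (measurable_one.indicator hs).comp hV
  rw [e0, lintegral_eq_zero_iff hm] at e
  filter_upwards [e] with z hz
  have : limitMass a (z.2 z.1.1) ∉ ({0, ∞} : Set ℝ≥0∞) := by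
    intro hmem
    simp [Set.indicator_of_mem hmem] at hz
  simpa using this

lemma ae_tiltedLaw_branchSum_ne_top (ha : ∀ i, Measurable fun t => a t i)
    (hfin : ∀ t i, a t i ≠ ∞) (h1 : ∫⁻ t, ∑' i, a t i ∂ν = 1) :
    ∀ᵐ z ∂(tiltedLaw a ν), branchSum a (z.1.2, z.2) ≠ ∞ := by
  have hU : Measurable fun z : (ℕ × E) × (ℕ → List ℕ → E) => branchSum a (z.1.2, z.2) :=
    (measurable_branchSum ha).comp (by fun_prop)
  have hs : MeasurableSet {x : ℝ≥0∞ | x ≠ ∞} := (measurableSet_singleton ∞).compl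
  have h : ∀ᵐ x ∂((tiltedLaw a ν).map fun z => limitMass a (z.2 z.1.1)), x ≠ ∞ :=
    (ae_map_iff (measurable_limitMass_chosen ha).aemeasurable hs).2
      ((ae_tiltedLaw_chosen ha h1).mono fun z hz => hz.2)
  rw [← map_branchSum_tiltedLaw ha hfin h1] at h
  exact (ae_map_iff hU.aemeasurable hs).1 h

end Spine

/-! ### Necessity of the negative mean logarithm. -/

section Necessity

variable {E : Type*} {a : E → ℕ → ℝ≥0∞} [MeasurableSpace E]
  {ν : Measure E} [IsProbabilityMeasure ν]

variable (a) in
/-- The logarithm of the limit of the whole tree, in terms of the label of the root and the subtrees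
of its children. -/
noncomputable def logBranchSum (z : (ℕ × E) × (ℕ → List ℕ → E)) : ℝ :=
  Real.log (branchSum a (z.1.2, z.2)).toReal

variable (a) in
/-- The logarithm of the limit of the subtree of the chosen child. -/
noncomputable def logChosen (z : (ℕ × E) × (ℕ → List ℕ → E)) : ℝ :=
  Real.log (limitMass a (z.2 z.1.1)).toReal

lemma measurable_branchSum_root (ha : ∀ i, Measurable fun t => a t i) :
    Measurable fun z : (ℕ × E) × (ℕ → List ℕ → E) => branchSum a (z.1.2, z.2) := by
  have h : Measurable fun z : (ℕ × E) × (ℕ → List ℕ → E) => (z.1.2, z.2) := by fun_prop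
  exact ((measurable_branchSum ha).comp h :)

lemma measurable_logBranchSum (ha : ∀ i, Measurable fun t => a t i) :
    Measurable (logBranchSum a) :=
  (measurable_branchSum_root ha).ennreal_toReal.log

lemma measurable_logChosen (ha : ∀ i, Measurable fun t => a t i) : Measurable (logChosen a) :=
  (measurable_limitMass_chosen ha).ennreal_toReal.log

lemma ae_tiltedLaw_of_ae_spineLaw (ha : ∀ i, Measurable fun t => a t i)
    (h1 : ∫⁻ t, ∑' i, a t i ∂ν = 1) {p : ℕ × E → Prop} (h : ∀ᵐ z ∂(spineLaw a ν), p z) :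
    ∀ᵐ z ∂(tiltedLaw a ν), p z.1 := by
  refine ae_of_ae_map measurable_fst.aemeasurable ?_
  rw [map_fst_tiltedLaw ha h1]
  exact Measure.ae_smul_measure h _

lemma integrable_tiltedLaw_fst (ha : ∀ i, Measurable fun t => a t i)
    (h1 : ∫⁻ t, ∑' i, a t i ∂ν = 1) {f : ℕ × E → ℝ} (hf : Integrable f (spineLaw a ν)) :
    Integrable (fun z => f z.1) (tiltedLaw a ν) := by
  have h : Integrable f ((tiltedLaw a ν).map Prod.fst) := by
    rw [map_fst_tiltedLaw ha h1]
    exact hf.smul_measure ((lintegral_limitMass_le_one ha h1).trans_lt ENNReal.one_lt_top).ne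
  exact h.comp_measurable measurable_fst

lemma integral_tiltedLaw_fst (ha : ∀ i, Measurable fun t => a t i)
    (h1 : ∫⁻ t, ∑' i, a t i ∂ν = 1) {f : ℕ × E → ℝ} (hf : Measurable f) :
    ∫ z, f z.1 ∂(tiltedLaw a ν) =
      (∫⁻ x, limitMass a x ∂(treeLaw ν)).toReal * ∫ z, f z ∂(spineLaw a ν) := by
  rw [← integral_map measurable_fst.aemeasurable hf.aestronglyMeasurable,
    map_fst_tiltedLaw ha h1, integral_smul_measure, smul_eq_mul]

/-- One term of a sum of nonnegative terms is at most the sum; when the logarithms agree, that term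
is the whole sum. -/
lemma ae_logWeight_add_logChosen_le (ha : ∀ i, Measurable fun t => a t i)
    (hfin : ∀ t i, a t i ≠ ∞) (h1 : ∫⁻ t, ∑' i, a t i ∂ν = 1) :
    ∀ᵐ z ∂(tiltedLaw a ν), logWeight a z.1 + logChosen a z ≤ logBranchSum a z ∧
      (logWeight a z.1 + logChosen a z = logBranchSum a z →
        branchSum a (z.1.2, z.2) = a z.1.2 z.1.1 * limitMass a (z.2 z.1.1)) := by
  filter_upwards [ae_tiltedLaw_of_ae_spineLaw ha h1 (ae_spineLaw_ne_zero ha),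
    ae_tiltedLaw_chosen ha h1, ae_tiltedLaw_branchSum_ne_top ha hfin h1] with z hz1 hz2 hz3
  have hle : a z.1.2 z.1.1 * limitMass a (z.2 z.1.1) ≤ branchSum a (z.1.2, z.2) :=
    ENNReal.le_tsum z.1.1
  have hpos : 0 < (a z.1.2 z.1.1 * limitMass a (z.2 z.1.1)).toReal :=
    ENNReal.toReal_pos (mul_ne_zero hz1 hz2.1) (ENNReal.mul_ne_top (hfin _ _) hz2.2)
  have hsum : logWeight a z.1 + logChosen a z =
      Real.log (a z.1.2 z.1.1 * limitMass a (z.2 z.1.1)).toReal := by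
    rw [ENNReal.toReal_mul, Real.log_mul (ENNReal.toReal_ne_zero.2 ⟨hz1, hfin _ _⟩)
      (ENNReal.toReal_ne_zero.2 hz2)]
    rfl
  have hle' := ENNReal.toReal_mono hz3 hle
  rw [hsum]
  refine ⟨Real.log_le_log hpos hle', fun h => ?_⟩
  have := Real.log_injOn_pos hpos (hpos.trans_le hle') h
  exact ((ENNReal.toReal_eq_toReal_iff' (ENNReal.mul_ne_top (hfin _ _) hz2.2) hz3).1 this).symm

/-- The difference is at most minus the log weight of the chosen child, which is integrable under
the first marginal. -/
lemma lintegral_logChosen_sub_lt_top (ha : ∀ i, Measurable fun t => a t i)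
    (hfin : ∀ t i, a t i ≠ ∞) (h1 : ∫⁻ t, ∑' i, a t i ∂ν = 1)
    (hlog : Integrable (logWeight a) (spineLaw a ν)) :
    ∫⁻ z, ENNReal.ofReal (logChosen a z - logBranchSum a z) ∂(tiltedLaw a ν) < ∞ := by
  refine lt_of_le_of_lt (lintegral_mono_ae ?_)
    (integrable_tiltedLaw_fst ha h1 hlog.neg).lintegral_lt_top
  filter_upwards [ae_logWeight_add_logChosen_le ha hfin h1] with z hz
  refine ENNReal.ofReal_le_ofReal ?_
  simp only [Pi.neg_apply]
  linarith [hz.1]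

lemma lintegral_logBranchSum_sub_le (ha : ∀ i, Measurable fun t => a t i)
    (hfin : ∀ t i, a t i ≠ ∞) (h1 : ∫⁻ t, ∑' i, a t i ∂ν = 1) :
    ∫⁻ z, ENNReal.ofReal (logBranchSum a z - logChosen a z) ∂(tiltedLaw a ν) ≤
      ∫⁻ z, ENNReal.ofReal (logChosen a z - logBranchSum a z) ∂(tiltedLaw a ν) := by
  have := isFiniteMeasure_tiltedLaw (ν := ν) ha h1
  refine lintegral_ofReal_sub_le_of_map_eq (measurable_logBranchSum ha)
    (measurable_logChosen ha) ?_
  have hl : Measurable fun w : ℝ≥0∞ => Real.log w.toReal := ENNReal.measurable_toReal.log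
  have e1 := Measure.map_map (μ := tiltedLaw a ν) hl (measurable_branchSum_root ha)
  have e2 := Measure.map_map (μ := tiltedLaw a ν) hl (measurable_limitMass_chosen ha)
  rw [map_branchSum_tiltedLaw ha hfin h1] at e1
  exact e1.symm.trans e2

lemma integrable_logBranchSum_sub (ha : ∀ i, Measurable fun t => a t i)
    (hfin : ∀ t i, a t i ≠ ∞) (h1 : ∫⁻ t, ∑' i, a t i ∂ν = 1)
    (hlog : Integrable (logWeight a) (spineLaw a ν)) :
    Integrable (fun z => logBranchSum a z - logChosen a z) (tiltedLaw a ν) := by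
  have hm : Measurable fun z => logBranchSum a z - logChosen a z :=
    (measurable_logBranchSum ha).sub (measurable_logChosen ha)
  have hlt := lintegral_logChosen_sub_lt_top (ν := ν) ha hfin h1 hlog
  refine ⟨hm.aestronglyMeasurable, ?_⟩
  refine lt_of_le_of_lt (lintegral_mono (g := fun z =>
    ENNReal.ofReal (logBranchSum a z - logChosen a z) +
      ENNReal.ofReal (logChosen a z - logBranchSum a z)) fun z => ?_) ?_
  · rw [Real.enorm_eq_ofReal_abs]
    rcases le_total 0 (logBranchSum a z - logChosen a z) with h | h
    · rw [abs_of_nonneg h]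
      exact le_self_add
    · rw [abs_of_nonpos h, neg_sub]
      exact le_add_self
  · rw [lintegral_add_left hm.ennreal_ofReal]
    exact ENNReal.add_lt_top.2
      ⟨(lintegral_logBranchSum_sub_le ha hfin h1).trans_lt hlt, hlt⟩

lemma integral_logBranchSum_sub_nonpos (ha : ∀ i, Measurable fun t => a t i)
    (hfin : ∀ t i, a t i ≠ ∞) (h1 : ∫⁻ t, ∑' i, a t i ∂ν = 1)
    (hlog : Integrable (logWeight a) (spineLaw a ν)) :
    ∫ z, (logBranchSum a z - logChosen a z) ∂(tiltedLaw a ν) ≤ 0 := by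
  rw [integral_eq_lintegral_pos_part_sub_lintegral_neg_part
    (integrable_logBranchSum_sub ha hfin h1 hlog), sub_nonpos]
  simp only [neg_sub]
  exact ENNReal.toReal_mono (lintegral_logChosen_sub_lt_top ha hfin h1 hlog).ne
    (lintegral_logBranchSum_sub_le ha hfin h1)

lemma forestLaw_two_ne_zero (ha : ∀ i, Measurable fun t => a t i) {i j : ℕ} (hij : i ≠ j) :
    forestLaw ν {y | limitMass a (y i) ≠ 0 ∧ limitMass a (y j) ≠ 0} =
      treeLaw ν {x | limitMass a x ≠ 0} ^ 2 := by
  have hm : MeasurableSet {x : List ℕ → E | limitMass a x ≠ 0} :=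
    (measurable_limitMass ha (measurableSet_singleton 0)).compl
  have := Measure.infinitePi_pi (fun _ : ℕ => treeLaw ν) (s := {i, j})
    (t := fun _ => {x | limitMass a x ≠ 0}) (fun _ _ => hm)
  rw [Finset.prod_const, Finset.card_pair hij] at this
  rw [← this]
  congr 1 with y
  simp

/-- With two children of nonzero weight, both subtrees would have nonzero limits with positive
probability by independence, and then neither term could be the whole sum. -/
lemma childCount_le_one_of_branchSum_eq (ha : ∀ i, Measurable fun t => a t i)
    (hfin : ∀ t i, a t i ≠ ∞) (h1 : ∫⁻ t, ∑' i, a t i ∂ν = 1)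
    (hW : treeLaw ν {x | limitMass a x = 0} < 1) {t : E}
    (h : ∀ᵐ y ∂(forestLaw ν), ∀ i, a t i * limitMass a (y i) ≠ 0 →
      branchSum a (t, y) = a t i * limitMass a (y i)) :
    childCount a t ≤ 1 := by
  have hpos : treeLaw ν {x | limitMass a x ≠ 0} ≠ 0 := by
    have hm : MeasurableSet {x : List ℕ → E | limitMass a x = 0} :=
      measurable_limitMass ha (measurableSet_singleton 0)
    intro h0
    exact hW.ne ((prob_compl_eq_zero_iff hm).1 h0)
  have htop : ∀ᵐ y ∂(forestLaw ν), ∀ i, limitMass a (y i) ≠ ∞ := by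
    rw [ae_all_iff]
    intro i
    exact (measurePreserving_eval_infinitePi (fun _ : ℕ => treeLaw ν) i).quasiMeasurePreserving.ae
      ((ae_tendsto_limitMass ha h1).mono fun x hx => hx.1.ne)
  rw [childCount_eq_encard]
  have : {i | a t i ≠ 0}.encard ≤ 1 := by
    rw [Set.encard_le_one_iff]
    intro i j hi hj
    by_contra hij
    have hnull : forestLaw ν {y | limitMass a (y i) ≠ 0 ∧ limitMass a (y j) ≠ 0} = 0 := by
      have h0 : ∀ᵐ y ∂(forestLaw ν), ¬ (limitMass a (y i) ≠ 0 ∧ limitMass a (y j) ≠ 0) := by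
        filter_upwards [h, htop] with y hy hy' ⟨h2, h3⟩
        have e := hy i (mul_ne_zero hi h2)
        have hle : a t i * limitMass a (y i) + a t j * limitMass a (y j) ≤ branchSum a (t, y) := by
          rw [← Finset.sum_pair (f := fun k => a t k * limitMass a (y k)) hij]
          exact ENNReal.sum_le_tsum _
        rw [e] at hle
        exact absurd hle (ENNReal.lt_add_right (ENNReal.mul_ne_top (hfin _ _) (hy' i))
          (mul_ne_zero hj h3)).not_ge
      simpa only [not_not] using ae_iff.1 h0
    rw [forestLaw_two_ne_zero ha hij] at hnull
    exact hpos (pow_eq_zero_iff two_ne_zero |>.1 hnull)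
  exact_mod_cast this

/-- If the limit does not vanish almost surely, the mean logarithm of the weights is negative. -/
lemma integral_logWeight_neg (ha : ∀ i, Measurable fun t => a t i)
    (hfin : ∀ t i, a t i ≠ ∞) (h1 : ∫⁻ t, ∑' i, a t i ∂ν = 1)
    (hN : 1 < ∫⁻ t, childCount a t ∂ν) (hlog : Integrable (logWeight a) (spineLaw a ν))
    (hW : treeLaw ν {x | limitMass a x = 0} < 1) :
    ∫ z, logWeight a z ∂(spineLaw a ν) < 0 := by
  by_contra! hκ
  have hint := integrable_logBranchSum_sub (ν := ν) ha hfin h1 hlog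
  have hintf := integrable_tiltedLaw_fst (ν := ν) ha h1 hlog
  have hD : Integrable (fun z => logBranchSum a z - logChosen a z - logWeight a z.1)
      (tiltedLaw a ν) := hint.sub hintf
  -- The integrand is nonnegative almost everywhere, yet its integral is at most -κ E[W] ≤ 0; hence
  -- it vanishes and the chosen term is the whole sum.
  have hD0 : ∫ z, (logBranchSum a z - logChosen a z - logWeight a z.1) ∂(tiltedLaw a ν) ≤ 0 := by
    rw [integral_sub hint hintf, integral_tiltedLaw_fst ha h1 (measurable_logWeight ha)]
    have := integral_logBranchSum_sub_nonpos (ν := ν) ha hfin h1 hlog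
    have := mul_nonneg (ENNReal.toReal_nonneg (a := ∫⁻ x, limitMass a x ∂(treeLaw ν))) hκ
    linarith
  have hDnn : 0 ≤ᵐ[tiltedLaw a ν] fun z => logBranchSum a z - logChosen a z - logWeight a z.1 := by
    filter_upwards [ae_logWeight_add_logChosen_le ha hfin h1] with z hz
    simp only [Pi.zero_apply]
    linarith [hz.1]
  have hDeq := (integral_eq_zero_iff_of_nonneg_ae hDnn hD).1
    (le_antisymm hD0 (integral_nonneg_of_ae hDnn))
  have hae : ∀ᵐ z ∂(tiltedLaw a ν),
      branchSum a (z.1.2, z.2) = a z.1.2 z.1.1 * limitMass a (z.2 z.1.1) := by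
    filter_upwards [hDeq, ae_logWeight_add_logChosen_le ha hfin h1] with z hz hz2
    simp only [Pi.zero_apply] at hz
    exact hz2.2 (by linarith)
  have hU := measurable_branchSum_root (a := a) ha
  have hV : Measurable fun z : (ℕ × E) × (ℕ → List ℕ → E) =>
      a z.1.2 z.1.1 * limitMass a (z.2 z.1.1) :=
    ((measurable_weight_prod ha).comp measurable_fst).mul (measurable_limitMass_chosen ha)
  set s : Set ((ℕ × E) × (ℕ → List ℕ → E)) :=
    {z | branchSum a (z.1.2, z.2) = a z.1.2 z.1.1 * limitMass a (z.2 z.1.1)}ᶜ with hs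
  have hsm : MeasurableSet s := (measurableSet_eq_fun hU hV).compl
  have hs0 : ∫⁻ z, s.indicator 1 z ∂(tiltedLaw a ν) = 0 := by
    rw [lintegral_indicator_one hsm]
    exact hae
  have hsi : Measurable (s.indicator (1 : (ℕ × E) × (ℕ → List ℕ → E) → ℝ≥0∞)) :=
    measurable_one.indicator hsm
  have hpm : Measurable fun p : E × (ℕ → List ℕ → E) =>
      ∑' i, a p.1 i * limitMass a (p.2 i) * s.indicator 1 ((i, p.1), p.2) := by
    refine Measurable.tsum fun i => Measurable.mul ?_ ?_
    · exact ((ha i).comp measurable_fst).mul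
        ((measurable_limitMass ha).comp ((measurable_pi_apply i).comp measurable_snd))
    · have hp : Measurable fun p : E × (ℕ → List ℕ → E) => ((i, p.1), p.2) := by fun_prop
      exact (hsi.comp hp :)
  rw [lintegral_tiltedLaw ha h1 hsi, lintegral_eq_zero_iff hpm.lintegral_prod_right'] at hs0
  have hcount : ∀ᵐ t ∂ν, childCount a t ≤ 1 := by
    filter_upwards [hs0] with t ht
    refine childCount_le_one_of_branchSum_eq ha hfin h1 hW ?_
    have hpt : Measurable fun y : ℕ → List ℕ → E =>
      ∑' i, a t i * limitMass a (y i) * s.indicator 1 ((i, t), y) :=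
      (hpm.comp (measurable_prodMk_left (x := t)) :)
    have ht' : ∫⁻ y, ∑' i, a t i * limitMass a (y i) * s.indicator 1 ((i, t), y)
      ∂(forestLaw ν) = 0 := ht
    rw [lintegral_eq_zero_iff hpt] at ht'
    filter_upwards [ht'] with y hy i hi
    have := ENNReal.tsum_eq_zero.1 hy i
    by_contra hne
    have hmem : ((i, t), y) ∈ s := hne
    rw [Set.indicator_of_mem hmem] at this
    simp only [Pi.one_apply, mul_one] at this
    exact hi this
  have : ∫⁻ t, childCount a t ∂ν ≤ 1 := by
    simpa using lintegral_mono_ae hcount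
  exact absurd hN this.not_gt

end Necessity

/-! ### The positive logarithm. -/

section LogPlus

lemma logPlus_eq {x : ℝ≥0∞} (hx : x ≠ ∞) :
    BRW.logPlus x = ENNReal.ofReal (Real.log x.toReal) := by
  unfold BRW.logPlus
  by_cases h0 : x = 0
  · simp [h0]
  · rw [ENNReal.log_pos_real h0 hx, EReal.toENNReal_of_ne_top (EReal.coe_ne_top _),
      EReal.toReal_coe]

lemma logPlus_mul_le (x y : ℝ≥0∞) : BRW.logPlus (x * y) ≤ BRW.logPlus x + BRW.logPlus y := by
  unfold BRW.logPlus
  rw [ENNReal.log_mul_add]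
  exact EReal.toENNReal_add_le

lemma measurable_logPlus : Measurable BRW.logPlus := by
  unfold BRW.logPlus
  exact ENNReal.measurable_log.ereal_toENNReal

lemma logPlus_lt_top {x : ℝ≥0∞} (hx : x ≠ ∞) : BRW.logPlus x < ∞ := by
  rw [logPlus_eq hx]
  exact ENNReal.ofReal_lt_top

/-- Integrability of `Y log⁺ Y` is not affected by a finite factor. -/
lemma lintegral_mul_logPlus_lt_top {Z : Type*} [MeasurableSpace Z] {μ : Measure Z}
    {Y : Z → ℝ≥0∞} (hY : Measurable Y) (hYi : ∫⁻ z, Y z ∂μ ≠ ∞) {c : ℝ≥0∞} (hc : c ≠ ∞)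
    (h : ∫⁻ z, Y z * BRW.logPlus (Y z) ∂μ < ∞) :
    ∫⁻ z, c * Y z * BRW.logPlus (c * Y z) ∂μ < ∞ := by
  have hm : Measurable fun z => Y z * BRW.logPlus (Y z) := hY.mul (measurable_logPlus.comp hY)
  calc ∫⁻ z, c * Y z * BRW.logPlus (c * Y z) ∂μ
      ≤ ∫⁻ z, (c * BRW.logPlus c * Y z + c * (Y z * BRW.logPlus (Y z))) ∂μ := by
        refine lintegral_mono fun z => ?_
        calc c * Y z * BRW.logPlus (c * Y z)
            ≤ c * Y z * (BRW.logPlus c + BRW.logPlus (Y z)) := by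
              gcongr
              exact logPlus_mul_le _ _
          _ = _ := by ring
    _ = c * BRW.logPlus c * ∫⁻ z, Y z ∂μ + c * ∫⁻ z, Y z * BRW.logPlus (Y z) ∂μ := by
        rw [lintegral_add_left (hY.const_mul _), lintegral_const_mul _ hY,
          lintegral_const_mul _ hm]
    _ < ∞ := ENNReal.add_lt_top.2 ⟨ENNReal.mul_lt_top
        (ENNReal.mul_lt_top hc.lt_top (logPlus_lt_top hc)) hYi.lt_top,
        ENNReal.mul_lt_top hc.lt_top h⟩

end LogPlus

/-! ### Necessity of the X log X condition. -/

section Necessity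

variable {E : Type*} {a : E → ℕ → ℝ≥0∞} [MeasurableSpace E]
  {ν : Measure E} [IsProbabilityMeasure ν]

variable (a) in
/-- The limit, set to zero where it exceeds `K`. -/
noncomputable def cutLimit (K : ℕ) (x : List ℕ → E) : ℝ≥0∞ :=
  {x | limitMass a x ≤ K}.indicator (limitMass a) x

lemma measurable_cutLimit (ha : ∀ i, Measurable fun t => a t i) (K : ℕ) :
    Measurable (cutLimit a K) :=
  (measurable_limitMass ha).indicator ((measurable_limitMass ha) measurableSet_Iic)

lemma cutLimit_le {E : Type*} {a : E → ℕ → ℝ≥0∞} (K : ℕ) (x : List ℕ → E) :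
    cutLimit a K x ≤ limitMass a x :=
  Set.indicator_le_self _ _ x

lemma exists_lintegral_cutLimit_ne_zero (ha : ∀ i, Measurable fun t => a t i)
    (h1 : ∫⁻ t, ∑' i, a t i ∂ν = 1) (hW : treeLaw ν {x | limitMass a x = 0} < 1) :
    ∃ K : ℕ, ∫⁻ x, cutLimit a K x ∂(treeLaw ν) ≠ 0 := by
  by_contra! h
  have h0 : ∀ᵐ x ∂(treeLaw ν), ∀ K : ℕ, cutLimit a K x = 0 :=
    ae_all_iff.2 fun K => (lintegral_eq_zero_iff (measurable_cutLimit ha K)).1 (h K)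
  have hz : ∀ᵐ x ∂(treeLaw ν), limitMass a x = 0 := by
    filter_upwards [h0, ae_tendsto_limitMass ha h1] with x hx hx2
    obtain ⟨n, hn⟩ := ENNReal.exists_nat_gt hx2.1.ne
    have := hx n
    rwa [cutLimit, Set.indicator_of_mem (by exact hn.le)] at this
  have hm : MeasurableSet {x : List ℕ → E | limitMass a x = 0} :=
    measurable_limitMass ha (measurableSet_singleton 0)
  exact hW.ne ((prob_compl_eq_zero_iff hm).1 hz)

variable (a) in
/-- A logarithm of the limit of the whole tree, reduced by `log K`. -/
noncomputable def reducedLog (K : ℕ) (p : E × (ℕ → List ℕ → E)) : ℝ≥0∞ :=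
  ENNReal.ofReal (Real.log (branchSum a p).toReal - Real.log K)

lemma measurable_reducedLog (ha : ∀ i, Measurable fun t => a t i) (K : ℕ) :
    Measurable (reducedLog a K) :=
  ((measurable_branchSum ha).ennreal_toReal.log.sub measurable_const).ennreal_ofReal

lemma measurable_tsum_cutLimit (ha : ∀ i, Measurable fun t => a t i) (K : ℕ) :
    Measurable fun p : E × (ℕ → List ℕ → E) => ∑' i, a p.1 i * cutLimit a K (p.2 i) :=
  Measurable.tsum fun i => ((ha i).comp measurable_fst).mul
    ((measurable_cutLimit ha K).comp ((measurable_pi_apply i).comp measurable_snd))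

/-- This is a tilted integral over the event that the chosen limit is at most `K`. There log U - log
K ≤ log U - log V, whose positive part is integrable by equality in law. -/
lemma lintegral_cutLimit_mul_reducedLog_lt_top (ha : ∀ i, Measurable fun t => a t i)
    (hfin : ∀ t i, a t i ≠ ∞) (h1 : ∫⁻ t, ∑' i, a t i ∂ν = 1)
    (hlog : Integrable (logWeight a) (spineLaw a ν)) {K : ℕ} :
    ∫⁻ t, ∫⁻ y, (∑' i, a t i * cutLimit a K (y i)) * reducedLog a K (t, y)
      ∂(forestLaw ν) ∂ν < ∞ := by
  have hlt := (lintegral_logBranchSum_sub_le (ν := ν) ha hfin h1).trans_lt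
    (lintegral_logChosen_sub_lt_top ha hfin h1 hlog)
  refine lt_of_le_of_lt ?_ hlt
  have hV := measurable_limitMass_chosen (a := a) ha
  set s : Set ((ℕ × E) × (ℕ → List ℕ → E)) := {z | limitMass a (z.2 z.1.1) ≤ K} with hs
  have hsm : MeasurableSet s := hV measurableSet_Iic
  have hp : Measurable fun z : (ℕ × E) × (ℕ → List ℕ → E) => (z.1.2, z.2) := by fun_prop
  have hr : Measurable fun z : (ℕ × E) × (ℕ → List ℕ → E) => reducedLog a K (z.1.2, z.2) :=
    ((measurable_reducedLog ha K).comp hp :)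
  have e : ∫⁻ t, ∫⁻ y, (∑' i, a t i * cutLimit a K (y i)) * reducedLog a K (t, y)
      ∂(forestLaw ν) ∂ν =
      ∫⁻ z, s.indicator (fun z => reducedLog a K (z.1.2, z.2)) z ∂(tiltedLaw a ν) := by
    rw [lintegral_tiltedLaw ha h1 (hr.indicator hsm)]
    congr 1 with t
    congr 1 with y
    rw [← ENNReal.tsum_mul_right]
    congr 1 with i
    unfold cutLimit
    by_cases h : limitMass a (y i) ≤ K
    · have hmem : ((i, t), y) ∈ s := h
      rw [Set.indicator_of_mem hmem, Set.indicator_of_mem (by exact h)]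
    · have hmem : ((i, t), y) ∉ s := h
      rw [Set.indicator_of_notMem hmem, Set.indicator_of_notMem (by exact h)]
      simp
  rw [e]
  refine lintegral_mono_ae ?_
  filter_upwards [ae_tiltedLaw_chosen ha h1] with z hz
  by_cases h : z ∈ s
  · rw [Set.indicator_of_mem h]
    refine ENNReal.ofReal_le_ofReal (sub_le_sub_left ?_ _)
    refine Real.log_le_log (ENNReal.toReal_pos hz.1 hz.2) ?_
    have h' : limitMass a (z.2 z.1.1) ≤ K := h
    simpa using ENNReal.toReal_mono (ENNReal.natCast_ne_top K) h'
  · rw [Set.indicator_of_notMem h]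
    exact zero_le

/-- Either the truncated sum is at most c X and the last term suffices, or the full sum exceeds c X
and its logarithm dominates. -/
lemma mul_min_le_reducedLog {E : Type*} {a : E → ℕ → ℝ≥0∞} {K : ℕ} (N : ℕ) {c : ℝ≥0∞} {t : E}
    {y : ℕ → List ℕ → E} (hU : branchSum a (t, y) ≠ ∞) :
    (∑' i, a t i * cutLimit a K (y i)) *
        min (N : ℝ≥0∞) (ENNReal.ofReal (Real.log (c * ∑' i, a t i).toReal - Real.log K)) ≤
      (∑' i, a t i * cutLimit a K (y i)) * reducedLog a K (t, y) +
        c * (∑' i, a t i) *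
          min (N : ℝ≥0∞) (ENNReal.ofReal (Real.log (c * ∑' i, a t i).toReal - Real.log K)) := by
  rcases le_or_gt (∑' i, a t i * cutLimit a K (y i)) (c * ∑' i, a t i) with h | h
  · exact (mul_le_mul_left h _).trans le_add_self
  · refine le_add_right ?_
    gcongr
    refine (min_le_right _ _).trans ?_
    have hle : ∑' i, a t i * cutLimit a K (y i) ≤ branchSum a (t, y) :=
      ENNReal.tsum_le_tsum fun i => mul_le_mul_right (cutLimit_le K (y i)) _
    have hle2 := ENNReal.toReal_mono hU (h.le.trans hle)
    rcases (ENNReal.toReal_nonneg (a := c * ∑' i, a t i)).eq_or_lt with h0 | h0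
    · rw [← h0, Real.log_zero, zero_sub, ENNReal.ofReal_of_nonpos]
      · exact zero_le
      · have : 0 ≤ Real.log K := Real.log_natCast_nonneg K
        linarith
    · exact ENNReal.ofReal_le_ofReal (sub_le_sub_right (Real.log_le_log h0 hle2) _)

/-- If the limit does not vanish almost surely, then `X log⁺ X` is integrable for the sum `X` of the
weights. -/
lemma lintegral_mul_logPlus_lt_top_of_limitMass (ha : ∀ i, Measurable fun t => a t i)
    (hfin : ∀ t i, a t i ≠ ∞) (h1 : ∫⁻ t, ∑' i, a t i ∂ν = 1)
    (hlog : Integrable (logWeight a) (spineLaw a ν))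
    (hW : treeLaw ν {x | limitMass a x = 0} < 1) :
    ∫⁻ t, (∑' i, a t i) * BRW.logPlus (∑' i, a t i) ∂ν < ∞ := by
  obtain ⟨K, hw0⟩ := exists_lintegral_cutLimit_ne_zero (ν := ν) ha h1 hW
  set w := ∫⁻ x, cutLimit a K x ∂(treeLaw ν) with hw
  have hw1 : w ≤ 1 := (lintegral_mono (cutLimit_le K)).trans (lintegral_limitMass_le_one ha h1)
  have hwtop : w ≠ ∞ := (hw1.trans_lt ENNReal.one_lt_top).ne
  -- The truncated sum has conditional mean `w X`. With half of it as threshold, the error term can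
  -- be absorbed on the left.
  set c := w / 2 with hc
  have hc0 : c ≠ 0 := (ENNReal.half_pos hw0).ne'
  have hctop : c ≠ ∞ := ENNReal.div_ne_top hwtop two_ne_zero
  have hcw : c + c = w := ENNReal.add_halves w
  set X : E → ℝ≥0∞ := fun t => ∑' i, a t i with hX
  have hXm : Measurable X := Measurable.tsum ha
  set l : E → ℝ≥0∞ := fun t =>
    ENNReal.ofReal (Real.log (c * X t).toReal - Real.log K) with hl
  have hlm : Measurable l :=
    ((hXm.const_mul c).ennreal_toReal.log.sub measurable_const).ennreal_ofReal
  set C := ∫⁻ t, ∫⁻ y, (∑' i, a t i * cutLimit a K (y i)) * reducedLog a K (t, y)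
      ∂(forestLaw ν) ∂ν with hC
  have hCtop : C < ∞ := lintegral_cutLimit_mul_reducedLog_lt_top ha hfin h1 hlog
  have hbranch : ∀ᵐ t ∂ν, ∀ᵐ y ∂(forestLaw ν), branchSum a (t, y) ≠ ∞ := by
    have hb : ∫⁻ t, ∫⁻ y, branchSum a (t, y) ∂(forestLaw ν) ∂ν ≠ ∞ := by
      have := lintegral_comp_limitMass (ν := ν) ha hfin h1 (f := id) measurable_id
      simp only [id] at this
      rw [← this]
      exact ((lintegral_limitMass_le_one ha h1).trans_lt ENNReal.one_lt_top).ne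
    filter_upwards [ae_lt_top (measurable_branchSum ha).lintegral_prod_right' hb] with t ht
    have := ae_lt_top ((measurable_branchSum ha).comp (measurable_prodMk_left (x := t))) ht.ne
    exact this.mono fun y hy => hy.ne
  -- The cap `N` makes the integral finite, so that it may be cancelled; the bound does not depend
  -- on `N`.
  have hN : ∀ N : ℕ, ∫⁻ t, X t * min (N : ℝ≥0∞) (l t) ∂ν ≤ C / c := by
    intro N
    have hml : Measurable fun t => X t * min (N : ℝ≥0∞) (l t) := hXm.mul (measurable_const.min hlm)
    have hI : ∫⁻ t, X t * min (N : ℝ≥0∞) (l t) ∂ν ≠ ∞ := by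
      refine (lt_of_le_of_lt (lintegral_mono (g := fun t => X t * N) fun t => ?_) ?_).ne
      · exact mul_le_mul_right (min_le_left _ _) _
      · rw [lintegral_mul_const _ hXm, h1, one_mul]
        exact ENNReal.natCast_lt_top N
    have hmeas1 : Measurable fun p : E × (ℕ → List ℕ → E) =>
        (∑' i, a p.1 i * cutLimit a K (p.2 i)) * reducedLog a K p :=
      (measurable_tsum_cutLimit ha K).mul (measurable_reducedLog ha K)
    have hstep : ∀ᵐ t ∂ν, w * (X t * min (N : ℝ≥0∞) (l t)) ≤
        (∫⁻ y, (∑' i, a t i * cutLimit a K (y i)) * reducedLog a K (t, y) ∂(forestLaw ν)) +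
          c * (X t * min (N : ℝ≥0∞) (l t)) := by
      filter_upwards [hbranch] with t ht
      have hmono := lintegral_mono_ae (ht.mono fun y hy =>
        mul_min_le_reducedLog (a := a) (K := K) N (c := c) (t := t) hy)
      have hmt : Measurable fun y : ℕ → List ℕ → E =>
          (∑' i, a t i * cutLimit a K (y i)) * reducedLog a K (t, y) :=
        (hmeas1.comp (measurable_prodMk_left (x := t)) :)
      have hmt2 : Measurable fun y : ℕ → List ℕ → E => ∑' i, a t i * cutLimit a K (y i) :=
        ((measurable_tsum_cutLimit ha K).comp (measurable_prodMk_left (x := t)) :)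
      rw [lintegral_mul_const _ hmt2, lintegral_tsum_mul_eval (measurable_cutLimit ha K),
        lintegral_add_left hmt, lintegral_const, measure_univ, mul_one] at hmono
      calc w * (X t * min (N : ℝ≥0∞) (l t)) = X t * w * min (N : ℝ≥0∞) (l t) := by ring
        _ ≤ _ := hmono
        _ = _ := by rw [mul_assoc c]
    have hint := lintegral_mono_ae hstep
    rw [lintegral_const_mul _ hml, lintegral_add_left hmeas1.lintegral_prod_right',
      lintegral_const_mul _ hml, ← hC, ← hcw, add_mul] at hint
    have := (ENNReal.add_le_add_iff_right (ENNReal.mul_ne_top hctop hI)).1 hint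
    rw [ENNReal.le_div_iff_mul_le (Or.inl hc0) (Or.inl hctop), mul_comm]
    exact this
  have hXl : ∫⁻ t, X t * l t ∂ν < ∞ := by
    refine lt_of_le_of_lt ?_ (ENNReal.div_lt_top hCtop.ne hc0)
    have ht : Tendsto (fun N : ℕ => ∫⁻ t, X t * min (N : ℝ≥0∞) (l t) ∂ν) atTop
        (𝓝 (∫⁻ t, X t * l t ∂ν)) := by
      refine lintegral_tendsto_of_tendsto_of_monotone
        (fun N => (hXm.mul (measurable_const.min hlm)).aemeasurable)
        (ae_of_all _ fun t M N hMN => ?_) (ae_of_all _ fun t => ?_)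
      · exact mul_le_mul_right (min_le_min_right _ (by exact_mod_cast hMN)) _
      · refine tendsto_const_nhds.congr' ?_
        obtain ⟨n, hn⟩ := ENNReal.exists_nat_gt (r := l t) ENNReal.ofReal_ne_top
        filter_upwards [eventually_ge_atTop n] with N hN
        rw [min_eq_right (hn.le.trans (by exact_mod_cast hN))]
    exact le_of_tendsto' ht hN
  have hXfin : ∀ᵐ t ∂ν, X t < ∞ := ae_lt_top hXm (by rw [h1]; exact ENNReal.one_ne_top)
  have hXlm : Measurable fun t => X t * l t := hXm.mul hlm
  -- `log X` exceeds `log (c X) - log K` by the constant `log K - log c`.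
  set d := ENNReal.ofReal (Real.log K - Real.log c.toReal) with hd
  calc ∫⁻ t, X t * BRW.logPlus (X t) ∂ν ≤ ∫⁻ t, (X t * l t + X t * d) ∂ν := by
        refine lintegral_mono_ae (hXfin.mono fun t ht => ?_)
        rw [← mul_add]
        by_cases h0 : X t = 0
        · simp [h0]
        gcongr
        rw [logPlus_eq ht.ne, hl, hd]
        refine le_trans (ENNReal.ofReal_le_ofReal ?_) ENNReal.ofReal_add_le
        rw [ENNReal.toReal_mul, Real.log_mul (ENNReal.toReal_ne_zero.2 ⟨hc0, hctop⟩)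
          (ENNReal.toReal_ne_zero.2 ⟨h0, ht.ne⟩)]
        linarith
    _ = ∫⁻ t, X t * l t ∂ν + d := by
        rw [lintegral_add_left hXlm, lintegral_mul_const _ hXm, h1, one_mul]
    _ < ∞ := ENNReal.add_lt_top.2 ⟨hXl, ENNReal.ofReal_lt_top⟩

end Necessity

/-! ### Consequences of the strong law of large numbers. -/

section StrongLaw

variable {X : Type*} [MeasurableSpace X] {μ : Measure X} [IsProbabilityMeasure μ]

/-- The strong law of large numbers on an infinite product space. -/
lemma ae_tendsto_average {g : X → ℝ} (hg : Measurable g) (hi : Integrable g μ) :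
    ∀ᵐ ω ∂(Measure.infinitePi fun _ : ℕ => μ),
      Tendsto (fun n : ℕ => (∑ i ∈ Finset.range n, g (ω i)) / n) atTop (𝓝 (∫ x, g x ∂μ)) := by
  have hmp : ∀ k, MeasurePreserving (fun ω : ℕ → X => ω k) (Measure.infinitePi fun _ : ℕ => μ) μ :=
    measurePreserving_eval_infinitePi (fun _ : ℕ => μ)
  have hind : iIndepFun (fun (k : ℕ) (ω : ℕ → X) => g (ω k)) (Measure.infinitePi fun _ : ℕ => μ) :=
    iIndepFun_infinitePi (X := fun _ => g) fun _ => hg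
  have hmap : ∀ k, (Measure.infinitePi fun _ : ℕ => μ).map (fun ω => g (ω k)) = μ.map g := fun k =>
    (Measure.map_map hg (hmp k).measurable).symm.trans (by rw [(hmp k).map_eq])
  have h := strong_law_ae_real (μ := Measure.infinitePi fun _ : ℕ => μ)
    (fun k ω => g (ω k)) ((hmp 0).integrable_comp_of_integrable hi)
    (fun i j hij => hind.indepFun hij) fun k =>
      ⟨(hg.comp (measurable_pi_apply k)).aemeasurable,
        (hg.comp (measurable_pi_apply 0)).aemeasurable, (hmap k).trans (hmap 0).symm⟩
  have e : ∫ ω, g (ω 0) ∂(Measure.infinitePi fun _ : ℕ => μ) = ∫ x, g x ∂μ := by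
    have := integral_map (μ := Measure.infinitePi fun _ : ℕ => μ) (hmp 0).measurable.aemeasurable (f := g) hg.aestronglyMeasurable
    rw [(hmp 0).map_eq] at this
    exact this.symm
  rw [e] at h
  exact h

/-- Up to the factor (n + 1)/n, this is the difference of consecutive averages. -/
lemma tendsto_div_zero_of_tendsto_average {u : ℕ → ℝ} {l : ℝ}
    (h : Tendsto (fun n : ℕ => (∑ i ∈ Finset.range n, u i) / n) atTop (𝓝 l)) :
    Tendsto (fun n : ℕ => u n / n) atTop (𝓝 0) := by
  have h1 := (tendsto_add_atTop_iff_nat 1).2 h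
  have h2 : Tendsto (fun n : ℕ => ((n : ℝ) + 1) / n) atTop (𝓝 1) := by
    have : Tendsto (fun n : ℕ => 1 + 1 / (n : ℝ)) atTop (𝓝 (1 + 0)) :=
      tendsto_const_nhds.add tendsto_one_div_atTop_nhds_zero_nat
    rw [add_zero] at this
    refine this.congr' ?_
    filter_upwards [eventually_ne_atTop 0] with n hn
    have : (n : ℝ) ≠ 0 := Nat.cast_ne_zero.2 hn
    field_simp
  have h3 := (h1.mul h2).sub h
  rw [mul_one, sub_self] at h3
  refine h3.congr' ?_
  filter_upwards [eventually_ne_atTop 0] with n hn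
  have : (n : ℝ) ≠ 0 := Nat.cast_ne_zero.2 hn
  have : (n : ℝ) + 1 ≠ 0 := by positivity
  rw [Finset.sum_range_succ]
  push_cast
  field_simp
  ring

end StrongLaw

/-! ### The perpetuity along the spine. -/

section Perpetuity

variable {E : Type*} {a : E → ℕ → ℝ≥0∞}

variable (a) in
/-- The value at depth `n` of the random affine recursion driven by the labels along the spine. -/
noncomputable def perpetuity : ℕ → (ℕ → ℕ × E) → ℝ≥0∞
  | 0, _ => 1
  | n + 1, ω => (∑' i, a (ω 0).2 i) + a (ω 0).2 (ω 0).1 * perpetuity n fun k => ω (k + 1)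

variable (a) in
/-- A bound for all the values of the random affine recursion. -/
noncomputable def perpetuityBound (ω : ℕ → ℕ × E) : ℝ≥0∞ :=
  ∑' n, (∏ k ∈ Finset.range n, a (ω k).2 (ω k).1) * ((∑' i, a (ω n).2 i) + 1)

/-- Unrolling the recursion leaves a terminal product of chosen weights at depth `n`; the `+ 1` in
the terms of the bound accounts for it. -/
lemma perpetuity_le (n : ℕ) (ω : ℕ → ℕ × E) : perpetuity a n ω ≤ perpetuityBound a ω := by
  induction n generalizing ω with
  | zero =>
    have h := ENNReal.le_tsum
      (f := fun n => (∏ k ∈ Finset.range n, a (ω k).2 (ω k).1) * ((∑' i, a (ω n).2 i) + 1)) 0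
    rw [Finset.prod_range_zero, one_mul] at h
    exact le_add_self.trans h
  | succ n ih =>
    unfold perpetuityBound
    rw [tsum_eq_zero_add' ENNReal.summable, perpetuity]
    refine add_le_add (by simp) ?_
    refine (mul_le_mul_right (ih _) _).trans (le_of_eq ?_)
    unfold perpetuityBound
    rw [← ENNReal.tsum_mul_left]
    congr 1 with m
    rw [Finset.prod_range_succ', ← mul_assoc, mul_comm (a (ω 0).2 (ω 0).1)]

variable [MeasurableSpace E] {ν : Measure E}

lemma measurable_weightSum_prod (ha : ∀ i, Measurable fun t => a t i) :
    Measurable fun z : ℕ × E => ∑' i, a z.2 i :=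
  (Measurable.tsum ha).comp measurable_snd

lemma measurable_perpetuity (ha : ∀ i, Measurable fun t => a t i) (n : ℕ) :
    Measurable (perpetuity a n) := by
  induction n with
  | zero => exact measurable_const
  | succ n ih =>
    have h : Measurable fun (ω : ℕ → ℕ × E) (k : ℕ) => ω (k + 1) := by fun_prop
    exact ((measurable_weightSum_prod ha).comp (measurable_pi_apply 0)).add
      (((measurable_weight_prod ha).comp (measurable_pi_apply 0)).mul (ih.comp h))

variable [IsProbabilityMeasure ν]

/-- The products behave like exp(κ n + o(n)) with κ < 0, while log⁺ X_n = o(n), so the series is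
dominated by a geometric one. -/
lemma ae_perpetuityBound_lt_top (ha : ∀ i, Measurable fun t => a t i) (hfin : ∀ t i, a t i ≠ ∞)
    (h1 : ∫⁻ t, ∑' i, a t i ∂ν = 1) (hlog : Integrable (logWeight a) (spineLaw a ν))
    (hκ : ∫ z, logWeight a z ∂(spineLaw a ν) < 0)
    (hX : ∫⁻ t, (∑' i, a t i) * BRW.logPlus (∑' i, a t i) ∂ν < ∞) :
    ∀ᵐ ω ∂(Measure.infinitePi fun _ : ℕ => spineLaw a ν), perpetuityBound a ω < ∞ := by
  have := isProbabilityMeasure_spineLaw (ν := ν) ha h1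
  have hSm := measurable_weightSum_prod (a := a) ha
  have hLm : Measurable fun z : ℕ × E => BRW.logPlus (∑' i, a z.2 i) := measurable_logPlus.comp hSm
  -- Size-biasing turns the X log⁺ X condition into a finite mean of log⁺ X.
  have hLi : ∫⁻ z, BRW.logPlus (∑' i, a z.2 i) ∂(spineLaw a ν) ≠ ∞ := by
    rw [lintegral_spineLaw ha hLm]
    simp only [ENNReal.tsum_mul_right]
    exact hX.ne
  have hLreal : Integrable (fun z : ℕ × E => (BRW.logPlus (∑' i, a z.2 i)).toReal)
      (spineLaw a ν) := integrable_toReal_of_lintegral_ne_top hLm.aemeasurable hLi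
  have hae : ∀ᵐ z ∂(spineLaw a ν), a z.2 z.1 ≠ 0 ∧ BRW.logPlus (∑' i, a z.2 i) < ∞ :=
    (ae_spineLaw_ne_zero ha).and (ae_lt_top hLm hLi)
  have hae' : ∀ᵐ ω ∂(Measure.infinitePi fun _ : ℕ => spineLaw a ν),
      ∀ k, a (ω k).2 (ω k).1 ≠ 0 ∧ BRW.logPlus (∑' i, a (ω k).2 i) < ∞ := by
    rw [ae_all_iff]
    exact fun k => (measurePreserving_eval_infinitePi
      (fun _ : ℕ => spineLaw a ν) k).quasiMeasurePreserving.ae hae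
  filter_upwards [hae', ae_tendsto_average (measurable_logWeight ha) hlog,
    ae_tendsto_average hLm.ennreal_toReal hLreal] with ω hω hS hL
  set κ := ∫ z, logWeight a z ∂(spineLaw a ν)
  set L : ℕ → ℝ := fun n => (BRW.logPlus (∑' i, a (ω n).2 i)).toReal with hLdef
  set S : ℕ → ℝ := fun n => ∑ i ∈ Finset.range n, logWeight a (ω i) with hSdef
  have hXL : ∀ n, (∑' i, a (ω n).2 i) + 1 ≤ ENNReal.ofReal (2 * Real.exp (L n)) := by
    intro n
    have hXtop : ∑' i, a (ω n).2 i ≠ ∞ := by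
      intro h
      have := (hω n).2
      rw [h] at this
      simp [BRW.logPlus] at this
    have hle : (∑' i, a (ω n).2 i).toReal ≤ Real.exp (L n) := by
      rw [hLdef]
      simp only
      rw [logPlus_eq hXtop]
      rcases (ENNReal.toReal_nonneg (a := ∑' i, a (ω n).2 i)).eq_or_lt with h0 | h0
      · rw [← h0]
        positivity
      · calc (∑' i, a (ω n).2 i).toReal = Real.exp (Real.log (∑' i, a (ω n).2 i).toReal) :=
            (Real.exp_log h0).symm
          _ ≤ _ := Real.exp_le_exp.2 (by
            rw [ENNReal.toReal_ofReal']
            exact le_max_left _ _)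
    have hone : 1 ≤ Real.exp (L n) := Real.one_le_exp ENNReal.toReal_nonneg
    rw [← ENNReal.ofReal_toReal hXtop, ← ENNReal.ofReal_one,
      ← ENNReal.ofReal_add ENNReal.toReal_nonneg zero_le_one]
    exact ENNReal.ofReal_le_ofReal (by linarith)
  have hprod : ∀ n, ∏ k ∈ Finset.range n, a (ω k).2 (ω k).1 = ENNReal.ofReal (Real.exp (S n)) := by
    intro n
    rw [hSdef]
    simp only
    rw [Real.exp_sum, ENNReal.ofReal_prod_of_nonneg fun i _ => (Real.exp_pos _).le]
    refine Finset.prod_congr rfl fun k _ => ?_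
    rw [logWeight, Real.exp_log (ENNReal.toReal_pos (hω k).1 (hfin _ _)),
      ENNReal.ofReal_toReal (hfin _ _)]
  have hev : ∀ᶠ n : ℕ in atTop, S n + L n ≤ κ / 2 * n := by
    have ht := hS.add (tendsto_div_zero_of_tendsto_average hL)
    rw [add_zero] at ht
    filter_upwards [ht.eventually_lt_const (show κ < κ / 2 by linarith), eventually_gt_atTop 0]
      with n hn hn0
    rw [← add_div, div_lt_iff₀ (by exact_mod_cast hn0)] at hn
    exact hn.le
  have hsum : Summable fun n => Real.exp (S n) * (2 * Real.exp (L n)) := by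
    have hgeo : Summable fun n : ℕ => 2 * Real.exp (κ / 2) ^ n :=
      (summable_geometric_of_lt_one (Real.exp_pos _).le
        (Real.exp_lt_one_iff.2 (by linarith))).mul_left 2
    refine Summable.of_norm_bounded_eventually_nat hgeo ?_
    filter_upwards [hev] with n hn
    rw [Real.norm_of_nonneg (by positivity), ← Real.exp_nat_mul]
    calc Real.exp (S n) * (2 * Real.exp (L n)) = 2 * Real.exp (S n + L n) := by
          rw [Real.exp_add]
          ring
      _ ≤ 2 * Real.exp (n * (κ / 2)) := by
          gcongr
          linarith
  refine lt_of_le_of_lt (ENNReal.tsum_le_tsum fun n => ?_) hsum.tsum_ofReal_ne_top.lt_top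
  rw [hprod n, ENNReal.ofReal_mul (Real.exp_pos _).le]
  gcongr
  exact hXL n

end Perpetuity

/-! ### Sufficiency: uniform integrability through the spine. -/

section Sufficiency

variable {E : Type*} {a : E → ℕ → ℝ≥0∞} [MeasurableSpace E]
  {ν : Measure E} [IsProbabilityMeasure ν]

/-- One coordinate of an infinite product is independent of the family of all the others. -/
lemma measurePreserving_coordinate_split {X : Type*} [MeasurableSpace X] (μ : Measure X)
    [IsProbabilityMeasure μ] (i : ℕ) :
    MeasurePreserving (fun y : ℕ → X => (y i, fun j : ({i}ᶜ : Set ℕ) => y j))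
      (Measure.infinitePi fun _ => μ) (μ.prod (Measure.infinitePi fun _ => μ)) := by
  have he : Function.Injective (fun o : Option ({i}ᶜ : Set ℕ) => o.elim i fun j => (j : ℕ)) := by
    rintro (_ | ⟨j, hj⟩) (_ | ⟨k, hk⟩) h
    · rfl
    · exact absurd h.symm hk
    · exact absurd h hj
    · simpa using h
  exact (measurePreserving_option_split μ).comp (measurePreserving_infinitePi_comp μ he)

/-- Jensen for the concave min(1, ·): given the `i`-th coordinate, the independent others are
replaced by their means. Adding `w i` to those means only enlarges the bound and frees it from the
excluded index. -/
lemma lintegral_eval_mul_min_le {X : Type*} [MeasurableSpace X] (μ : Measure X)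
    [IsProbabilityMeasure μ] {M : X → ℝ≥0∞} (hM : Measurable M) (hM1 : ∫⁻ x, M x ∂μ = 1)
    (w : ℕ → ℝ≥0∞) (i : ℕ) (c b : ℝ≥0∞) :
    ∫⁻ y, M (y i) * min 1 (c * (∑' j, w j * M (y j)) + b) ∂(Measure.infinitePi fun _ : ℕ => μ) ≤
      ∫⁻ x, M x * min 1 (c * w i * M x + (c * (∑' j, w j) + b)) ∂μ := by
  have hMj : ∀ j : ({i}ᶜ : Set ℕ), Measurable fun y : ({i}ᶜ : Set ℕ) → X => w j * M (y j) :=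
    fun j => (hM.comp (measurable_pi_apply j)).const_mul _
  have hR : Measurable fun y : ({i}ᶜ : Set ℕ) → X => ∑' j : ({i}ᶜ : Set ℕ), w j * M (y j) :=
    Measurable.tsum hMj
  set R : (({i}ᶜ : Set ℕ) → X) → ℝ≥0∞ := fun y => ∑' j : ({i}ᶜ : Set ℕ), w j * M (y j) with hRdef
  have hRint : ∫⁻ y, R y ∂(Measure.infinitePi fun _ : ({i}ᶜ : Set ℕ) => μ) ≤ ∑' j, w j := by
    rw [hRdef, lintegral_tsum fun j => (hMj j).aemeasurable]
    refine le_trans (le_of_eq ?_) (ENNReal.tsum_comp_le_tsum_of_injective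
      (Subtype.val_injective (p := fun j => j ∈ ({i}ᶜ : Set ℕ))) w)
    congr 1 with j
    have hj := (measurePreserving_eval_infinitePi
      (fun _ : ({i}ᶜ : Set ℕ) => μ) j).lintegral_comp hM
    rw [lintegral_const_mul _ (by exact hM.comp (measurable_pi_apply j))]
    exact (congrArg (fun r => w j * r) (hj.trans hM1)).trans (mul_one _)
  have hsplit : ∀ y : ℕ → X, ∑' j, w j * M (y j) =
      w i * M (y i) + R fun j : ({i}ᶜ : Set ℕ) => y j := by
    intro y
    rw [← ENNReal.summable.tsum_add_tsum_compl (s := {i}) ENNReal.summable,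
      tsum_singleton i fun j => w j * M (y j)]
  have hF : Measurable fun p : X × (({i}ᶜ : Set ℕ) → X) =>
      M p.1 * min 1 (c * (w i * M p.1 + R p.2) + b) :=
    (hM.comp measurable_fst).mul (measurable_const.min (((((hM.comp measurable_fst).const_mul
      _).add (hR.comp measurable_snd)).const_mul _).add_const _))
  simp_rw [hsplit]
  have e := (measurePreserving_coordinate_split μ i).lintegral_comp hF
  refine (e.trans (lintegral_prod _ hF.aemeasurable)).trans_le (lintegral_mono fun x => ?_)
  have hin : Measurable fun y : ({i}ᶜ : Set ℕ) → X => c * (w i * M x + R y) + b :=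
    ((hR.const_add _).const_mul _).add_const _
  simp only
  rw [lintegral_const_mul _ (measurable_const.min hin)]
  gcongr
  refine le_min ?_ ?_
  · calc _ ≤ ∫⁻ _, 1 ∂(Measure.infinitePi fun _ : ({i}ᶜ : Set ℕ) => μ) :=
          lintegral_mono fun _ => min_le_left _ _
      _ = 1 := by simp
  · calc _ ≤ ∫⁻ y, (c * w i * M x + b + c * R y)
          ∂(Measure.infinitePi fun _ : ({i}ᶜ : Set ℕ) => μ) :=
          lintegral_mono fun y => (min_le_right _ _).trans (le_of_eq (by ring))
      _ = c * w i * M x + b + c * ∫⁻ y, R y ∂(Measure.infinitePi fun _ : ({i}ᶜ : Set ℕ) => μ) := by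
          rw [lintegral_add_left measurable_const, lintegral_const_mul _ hR]
          simp
      _ ≤ c * w i * M x + b + c * ∑' j, w j := by gcongr
      _ = _ := by ring

variable (a ν) in
/-- The mean of `W (1 ∧ (c W + b))` for the total weight `W` of generation `n`. -/
noncomputable def tailMean (n : ℕ) (c b : ℝ≥0∞) : ℝ≥0∞ :=
  ∫⁻ x, mass a n x * min 1 (c * mass a n x + b) ∂(treeLaw ν)

/-- The bias by the total mass selects a child. Its weight multiplies `c`, and the mean contribution
of its siblings is moved into `b`. -/
lemma tailMean_succ_le (ha : ∀ i, Measurable fun t => a t i)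
    (h1 : ∫⁻ t, ∑' i, a t i ∂ν = 1) (n : ℕ) (c b : ℝ≥0∞) :
    tailMean a ν (n + 1) c b ≤
      ∫⁻ t, ∑' i, a t i * tailMean a ν n (c * a t i) (c * (∑' j, a t j) + b) ∂ν := by
  have hM := measurable_mass (a := a) ha n
  have hS : Measurable fun p : E × (ℕ → List ℕ → E) => ∑' i, a p.1 i * mass a n (p.2 i) :=
    Measurable.tsum fun i => ((ha i).comp measurable_fst).mul
      (hM.comp ((measurable_pi_apply i).comp measurable_snd))
  have hF : Measurable fun p : E × (ℕ → List ℕ → E) => (∑' i, a p.1 i * mass a n (p.2 i)) *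
      min 1 (c * (∑' i, a p.1 i * mass a n (p.2 i)) + b) :=
    hS.mul (measurable_const.min ((hS.const_mul _).add_const _))
  unfold tailMean
  simp_rw [mass_succ_root]
  refine (lintegral_treeLaw ν hF).trans_le (lintegral_mono fun t => ?_)
  have hSt : Measurable fun y : ℕ → List ℕ → E => ∑' i, a t i * mass a n (y i) :=
    (hS.comp (measurable_prodMk_left (x := t)) :)
  have hmin : Measurable fun y : ℕ → List ℕ → E =>
      min 1 (c * (∑' i, a t i * mass a n (y i)) + b) :=
    measurable_const.min ((hSt.const_mul _).add_const _)
  have hterm : ∀ i, Measurable fun y : ℕ → List ℕ → E =>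
      mass a n (y i) * min 1 (c * (∑' i, a t i * mass a n (y i)) + b) := fun i =>
    (hM.comp (measurable_pi_apply i)).mul hmin
  simp_rw [← ENNReal.tsum_mul_right, mul_assoc]
  rw [lintegral_tsum fun i => ((hterm i).const_mul _).aemeasurable]
  refine ENNReal.tsum_le_tsum fun i => ?_
  rw [lintegral_const_mul _ (hterm i)]
  gcongr
  refine (lintegral_eval_mul_min_le (treeLaw ν) hM (lintegral_mass ha h1 n) (a t) i c b).trans ?_
  simp_rw [mul_assoc]
  exact le_rfl

/-- Iterating the one-step bound composes random affine maps along the spine, so the induction must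
run over all `c` and `b`. -/
lemma tailMean_le (ha : ∀ i, Measurable fun t => a t i)
    (h1 : ∫⁻ t, ∑' i, a t i ∂ν = 1) (n : ℕ) (c b : ℝ≥0∞) :
    tailMean a ν n c b ≤
      ∫⁻ ω, min 1 (c * perpetuity a n ω + b) ∂(Measure.infinitePi fun _ : ℕ => spineLaw a ν) := by
  have := isProbabilityMeasure_spineLaw (ν := ν) ha h1
  induction n generalizing c b with
  | zero => simp [tailMean, mass_zero, perpetuity]
  | succ n ih =>
    have hA := measurable_weight_prod (a := a) ha
    have hX := measurable_weightSum_prod (a := a) ha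
    have hV := measurable_perpetuity (a := a) ha n
    have hG : Measurable fun p : (ℕ × E) × (ℕ → ℕ × E) =>
        min 1 (c * a p.1.2 p.1.1 * perpetuity a n p.2 + (c * (∑' j, a p.1.2 j) + b)) :=
      measurable_const.min ((((hA.comp measurable_fst).const_mul c).mul
        (hV.comp measurable_snd)).add (((hX.comp measurable_fst).const_mul c).add_const b))
    have e := (measurePreserving_head_tail (spineLaw a ν)).lintegral_comp hG
    calc tailMean a ν (n + 1) c b
        ≤ ∫⁻ t, ∑' i, a t i * tailMean a ν n (c * a t i) (c * (∑' j, a t j) + b) ∂ν :=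
          tailMean_succ_le ha h1 n c b
      _ ≤ ∫⁻ t, ∑' i, a t i * ∫⁻ ω, min 1 (c * a t i * perpetuity a n ω +
            (c * (∑' j, a t j) + b)) ∂(Measure.infinitePi fun _ : ℕ => spineLaw a ν) ∂ν := by
          gcongr
          exact ih _ _
      _ = ∫⁻ z, ∫⁻ ω, min 1 (c * a z.2 z.1 * perpetuity a n ω + (c * (∑' j, a z.2 j) + b))
            ∂(Measure.infinitePi fun _ : ℕ => spineLaw a ν) ∂(spineLaw a ν) :=
          (lintegral_spineLaw ha hG.lintegral_prod_right').symm
      _ = ∫⁻ ω, min 1 (c * perpetuity a (n + 1) ω + b)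
            ∂(Measure.infinitePi fun _ : ℕ => spineLaw a ν) := by
          refine ((lintegral_prod _ hG.aemeasurable).symm.trans e.symm).trans ?_
          refine lintegral_congr fun ω => ?_
          simp only [perpetuity]
          congr 1
          ring

/-- If the mean logarithm of the weights is negative and `X log⁺ X` is integrable, then the limit
has mean `1`. -/
lemma lintegral_limitMass_eq_one (ha : ∀ i, Measurable fun t => a t i) (hfin : ∀ t i, a t i ≠ ∞)
    (h1 : ∫⁻ t, ∑' i, a t i ∂ν = 1) (hlog : Integrable (logWeight a) (spineLaw a ν))
    (hκ : ∫ z, logWeight a z ∂(spineLaw a ν) < 0)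
    (hX : ∫⁻ t, (∑' i, a t i) * BRW.logPlus (∑' i, a t i) ∂ν < ∞) :
    ∫⁻ x, limitMass a x ∂(treeLaw ν) = 1 := by
  refine le_antisymm (lintegral_limitMass_le_one ha h1) ?_
  have := isProbabilityMeasure_spineLaw (ν := ν) ha h1
  set Q := Measure.infinitePi fun _ : ℕ => spineLaw a ν
  have hZm : Measurable (perpetuityBound a) := by
    refine Measurable.tsum fun n => Measurable.mul ?_ ?_
    · exact Finset.measurable_prod _ fun k _ =>
        (measurable_weight_prod ha).comp (measurable_pi_apply k)
    · exact ((measurable_weightSum_prod ha).comp (measurable_pi_apply n)).add_const 1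
  have htail : Tendsto (fun K : ℕ => ∫⁻ ω, min 1 ((K : ℝ≥0∞)⁻¹ * perpetuityBound a ω) ∂Q) atTop
      (𝓝 0) := by
    have h0 : ∫⁻ _, (0 : ℝ≥0∞) ∂Q = 0 := lintegral_zero
    rw [← h0]
    refine tendsto_lintegral_of_dominated_convergence (fun _ => 1)
      (fun K => measurable_const.min (hZm.const_mul _)) (fun K => ae_of_all _ fun ω =>
        min_le_left _ _) (by simp) ?_
    filter_upwards [ae_perpetuityBound_lt_top ha hfin h1 hlog hκ hX] with ω hω
    have : Tendsto (fun K : ℕ => min 1 ((K : ℝ≥0∞)⁻¹ * perpetuityBound a ω)) atTop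
        (𝓝 (min 1 (0 * perpetuityBound a ω))) :=
      tendsto_const_nhds.min (ENNReal.Tendsto.mul_const ENNReal.tendsto_inv_nat_nhds_zero
        (Or.inr hω.ne))
    simpa using this
  have hK : ∀ K : ℕ, 1 ≤ ∫⁻ ω, min 1 ((K : ℝ≥0∞)⁻¹ * perpetuityBound a ω) ∂Q +
      ∫⁻ x, limitMass a x ∂(treeLaw ν) := by
    intro K
    -- From M ≤ M min(1, M/K) + min(M, K): the first mean is bounded uniformly in `n`, and the
    -- second converges boundedly.
    have hn : ∀ n, 1 ≤ ∫⁻ ω, min 1 ((K : ℝ≥0∞)⁻¹ * perpetuityBound a ω) ∂Q +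
        ∫⁻ x, min (mass a n x) K ∂(treeLaw ν) := by
      intro n
      have hM := measurable_mass (a := a) ha n
      calc 1 = ∫⁻ x, mass a n x ∂(treeLaw ν) := (lintegral_mass ha h1 n).symm
        _ ≤ ∫⁻ x, (mass a n x * min 1 ((K : ℝ≥0∞)⁻¹ * mass a n x + 0) + min (mass a n x) K)
            ∂(treeLaw ν) := by
            refine lintegral_mono fun x => ?_
            rcases le_total (mass a n x) K with h | h
            · rw [min_eq_left h]
              exact le_add_self
            · refine le_add_right ?_
              -- For `K = 0` the inverse is ∞, so the minimum is 1 unless the mass vanishes.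
              rcases eq_or_ne K 0 with rfl | hK0
              · by_cases hm : mass a n x = 0
                · simp [hm]
                · simp [ENNReal.top_mul hm]
              · have : 1 ≤ (K : ℝ≥0∞)⁻¹ * mass a n x + 0 := by
                  rw [add_zero, mul_comm, ← div_eq_mul_inv,
                    ENNReal.le_div_iff_mul_le (Or.inl (Nat.cast_ne_zero.2 hK0))
                      (Or.inl (ENNReal.natCast_ne_top K)), one_mul]
                  exact h
                rw [min_eq_left this, mul_one]
        _ = tailMean a ν n (K : ℝ≥0∞)⁻¹ 0 + ∫⁻ x, min (mass a n x) K ∂(treeLaw ν) :=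
            lintegral_add_right _ (hM.min measurable_const)
        _ ≤ _ := by
            gcongr
            refine (tailMean_le ha h1 n _ _).trans (lintegral_mono fun ω => ?_)
            rw [add_zero]
            gcongr
            exact perpetuity_le n ω
    have hlim : Tendsto (fun n => ∫⁻ x, min (mass a n x) K ∂(treeLaw ν)) atTop
        (𝓝 (∫⁻ x, min (limitMass a x) K ∂(treeLaw ν))) := by
      refine tendsto_lintegral_of_dominated_convergence (fun _ => (K : ℝ≥0∞))
        (fun n => (measurable_mass ha n).min measurable_const) (fun n => ae_of_all _ fun x =>
          min_le_right _ _) (by simp) ?_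
      filter_upwards [ae_tendsto_limitMass ha h1] with x hx
      exact hx.2.min tendsto_const_nhds
    refine (ge_of_tendsto' (hlim.const_add _) hn).trans ?_
    gcongr
    exact min_le_left _ _
  have := ge_of_tendsto' (htail.add_const (∫⁻ x, limitMass a x ∂(treeLaw ν))) hK
  rwa [zero_add] at this

end Sufficiency

/-! ### From the branching random walk to the cascade. -/

section Transfer

open BRW

lemma measurable_entry (i : ℕ) : Measurable fun t : Tuple => t.entry i :=
  (measurable_pi_apply i).comp (measurable_snd.comp measurable_subtype_coe)

lemma measurableSet_lt_len (i : ℕ) : MeasurableSet {t : Tuple | (i : ℕ∞) < t.len} :=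
  (measurable_fst.comp measurable_subtype_coe) (MeasurableSet.of_discrete (s := {l | (i : ℕ∞) < l}))

open Classical in
/-- The summand `exp (-α X_i)` of `⟨α, 𝓛⟩`. -/
noncomputable def expTerm (α : ℝ) (t : Tuple) (i : ℕ) : ℝ≥0∞ :=
  if (i : ℕ∞) < t.len then ENNReal.ofReal (Real.exp (-α * t.entry i)) else 0

lemma measurable_expTerm (α : ℝ) (i : ℕ) : Measurable fun t => expTerm α t i := by
  classical
  exact Measurable.ite (measurableSet_lt_len i)
    (((measurable_entry i).const_mul (-α)).exp.ennreal_ofReal) measurable_const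

lemma expTerm_ne_top (α : ℝ) (t : Tuple) (i : ℕ) : expTerm α t i ≠ ∞ := by
  unfold expTerm
  split_ifs
  exacts [ENNReal.ofReal_ne_top, ENNReal.zero_ne_top]

lemma expTerm_eq_zero {α : ℝ} {t : Tuple} {i : ℕ} :
    expTerm α t i = 0 ↔ ¬ (i : ℕ∞) < t.len := by
  unfold expTerm
  split_ifs with h
  · simp [h, Real.exp_pos]
  · simp [h]

lemma pairing_eq_tsum_expTerm (α : ℝ) (t : Tuple) : pairing α t = ∑' i, expTerm α t i := rfl

lemma measurable_pairing (α : ℝ) : Measurable (pairing α) :=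
  Measurable.tsum fun i => measurable_expTerm α i

/-- The weights `exp (-α X_i) / m(α)`. -/
noncomputable def normalizedTerm (ν : Measure Tuple) (α : ℝ) (t : Tuple) (i : ℕ) : ℝ≥0∞ :=
  (m ν α)⁻¹ * expTerm α t i

/-- Exponentials are positive, so a zero mean would mean almost surely no children, whatever the
exponent. -/
lemma m_ne_zero {ν : Measure Tuple} (hsuper : 1 < m ν 0) (α : ℝ) : m ν α ≠ 0 := by
  intro h
  have h0 := (lintegral_eq_zero_iff (measurable_pairing α)).1 h
  have : m ν 0 = 0 := by
    refine (lintegral_eq_zero_iff (measurable_pairing 0)).2 (h0.mono fun t ht => ?_)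
    rw [Pi.zero_apply, pairing_eq_tsum_expTerm, ENNReal.tsum_eq_zero] at ht ⊢
    exact fun i => expTerm_eq_zero.2 (expTerm_eq_zero.1 (ht i))
  rw [this] at hsuper
  exact absurd hsuper (by simp)

section NormalizedTerm

variable {ν : Measure Tuple} {α : ℝ}

lemma measurable_normalizedTerm (i : ℕ) : Measurable fun t => normalizedTerm ν α t i :=
  (measurable_expTerm α i).const_mul _

lemma normalizedTerm_ne_top (h0 : m ν α ≠ 0) (t : Tuple) (i : ℕ) : normalizedTerm ν α t i ≠ ∞ :=
  ENNReal.mul_ne_top (ENNReal.inv_ne_top.2 h0) (expTerm_ne_top _ _ _)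

lemma normalizedTerm_eq_zero (hm : m ν α < ∞) {t : Tuple} {i : ℕ} :
    normalizedTerm ν α t i = 0 ↔ ¬ (i : ℕ∞) < t.len := by
  rw [normalizedTerm, mul_eq_zero, expTerm_eq_zero]
  simp [hm.ne]

lemma tsum_normalizedTerm (t : Tuple) :
    ∑' i, normalizedTerm ν α t i = (m ν α)⁻¹ * pairing α t := ENNReal.tsum_mul_left

lemma lintegral_tsum_normalizedTerm (h0 : m ν α ≠ 0) (hm : m ν α < ∞) :
    ∫⁻ t, ∑' i, normalizedTerm ν α t i ∂ν = 1 := by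
  simp_rw [tsum_normalizedTerm]
  rw [lintegral_const_mul _ (measurable_pairing α)]
  exact ENNReal.inv_mul_cancel h0 hm.ne

/-- Nonzero weights mark exactly the actual children, so m(0) > 1 becomes supercriticality of the
cascade. -/
lemma childCount_normalizedTerm (hm : m ν α < ∞) (t : Tuple) :
    childCount (normalizedTerm ν α) t = pairing 0 t := by
  unfold childCount pairing
  congr 1 with i
  by_cases h : (i : ℕ∞) < t.len
  · have : normalizedTerm ν α t i ≠ 0 := fun h' => normalizedTerm_eq_zero hm |>.1 h' h
    simp [this, h]
  · simp [normalizedTerm_eq_zero hm |>.2 h, h]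

lemma lintegral_pairing_mul_logPlus_iff (h0 : m ν α ≠ 0) (hm : m ν α < ∞) :
    ∫⁻ t, pairing α t * logPlus (pairing α t) ∂ν < ∞ ↔
      ∫⁻ t, (∑' i, normalizedTerm ν α t i) * logPlus (∑' i, normalizedTerm ν α t i) ∂ν < ∞ := by
  constructor
  · intro h
    simp_rw [tsum_normalizedTerm]
    exact lintegral_mul_logPlus_lt_top (measurable_pairing α) hm.ne (ENNReal.inv_ne_top.2 h0) h
  · intro h
    have h' := lintegral_mul_logPlus_lt_top (c := m ν α)
      (Measurable.tsum fun i => measurable_normalizedTerm (ν := ν) (α := α) i)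
      (by rw [lintegral_tsum_normalizedTerm h0 hm]; exact ENNReal.one_ne_top) hm.ne h
    have e : ∀ t, m ν α * ∑' i, normalizedTerm ν α t i = pairing α t := fun t => by
      rw [tsum_normalizedTerm, ← mul_assoc, ENNReal.mul_inv_cancel h0 hm.ne, one_mul]
    simpa only [e] using h'

lemma toReal_normalizedTerm_mul_entry (t : Tuple) (i : ℕ) :
    (normalizedTerm ν α t i).toReal * t.entry i = (m ν α).toReal⁻¹ * derivTerm α t i := by
  unfold normalizedTerm expTerm derivTerm
  split_ifs
  · rw [ENNReal.toReal_mul, ENNReal.toReal_inv, ENNReal.toReal_ofReal (Real.exp_pos _).le]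
    ring
  · simp

lemma measurable_derivTerm_prod : Measurable fun z : ℕ × Tuple => derivTerm α z.2 z.1 := by
  classical
  refine measurable_from_prod_countable_right fun i => ?_
  exact Measurable.ite (measurableSet_lt_len i)
    ((measurable_entry i).mul ((measurable_entry i).const_mul (-α)).exp) measurable_const

lemma ae_logWeight_normalizedTerm (h0 : m ν α ≠ 0) (hm : m ν α < ∞) :
    ∀ᵐ z ∂(spineLaw (normalizedTerm ν α) ν), logWeight (normalizedTerm ν α) z =
      -α * z.2.entry z.1 - Real.log (m ν α).toReal := by
  filter_upwards [ae_spineLaw_ne_zero (ν := ν) (measurable_normalizedTerm (ν := ν) (α := α))]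
    with z hz
  have h : (z.1 : ℕ∞) < z.2.len := by
    by_contra h
    exact hz (normalizedTerm_eq_zero hm |>.2 h)
  rw [logWeight, normalizedTerm, expTerm, if_pos h, ENNReal.toReal_mul, ENNReal.toReal_inv,
    ENNReal.toReal_ofReal (Real.exp_pos _).le,
    Real.log_mul (inv_ne_zero (ENNReal.toReal_ne_zero.2 ⟨h0, hm.ne⟩)) (Real.exp_ne_zero _),
    Real.log_inv, Real.log_exp]
  ring

variable [IsProbabilityMeasure ν]

lemma integrable_derivTerm (hm' : FiniteDeriv ν α) :
    Integrable (fun z : ℕ × Tuple => derivTerm α z.2 z.1) (Measure.count.prod ν) := by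
  refine ⟨measurable_derivTerm_prod.aestronglyMeasurable, ?_⟩
  unfold HasFiniteIntegral
  rw [lintegral_prod_symm _ measurable_derivTerm_prod.enorm.aemeasurable]
  simp_rw [lintegral_count]
  exact hm'

lemma integral_derivTerm (hm' : FiniteDeriv ν α) :
    ∫ z : ℕ × Tuple, derivTerm α z.2 z.1 ∂(Measure.count.prod ν) = -mDeriv ν α := by
  have hi := integrable_derivTerm hm'
  rw [integral_prod_symm _ hi, mDeriv, neg_neg]
  refine integral_congr_ae (hi.prod_left_ae.mono fun t ht => ?_)
  simp only
  rw [integral_countable ht]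
  simp [Measure.real]

lemma integrable_entry (h0 : m ν α ≠ 0) (hm' : FiniteDeriv ν α) :
    Integrable (fun z : ℕ × Tuple => z.2.entry z.1) (spineLaw (normalizedTerm ν α) ν) := by
  rw [spineLaw, integrable_withDensity_iff_integrable_smul'
    (measurable_weight_prod measurable_normalizedTerm)
    (ae_of_all _ fun z => (normalizedTerm_ne_top h0 _ _).lt_top)]
  simp_rw [smul_eq_mul, toReal_normalizedTerm_mul_entry]
  exact (integrable_derivTerm hm').const_mul _

lemma integral_entry (h0 : m ν α ≠ 0) (hm' : FiniteDeriv ν α) :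
    ∫ z : ℕ × Tuple, z.2.entry z.1 ∂(spineLaw (normalizedTerm ν α) ν) =
      -((m ν α).toReal⁻¹ * mDeriv ν α) := by
  rw [spineLaw, integral_withDensity_eq_integral_toReal_smul
    (measurable_weight_prod measurable_normalizedTerm)
    (ae_of_all _ fun z => (normalizedTerm_ne_top h0 _ _).lt_top)]
  simp_rw [smul_eq_mul, toReal_normalizedTerm_mul_entry]
  rw [integral_const_mul, integral_derivTerm hm', mul_neg]

lemma integrable_logWeight_normalizedTerm (h0 : m ν α ≠ 0) (hm : m ν α < ∞)
    (hm' : FiniteDeriv ν α) :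
    Integrable (logWeight (normalizedTerm ν α)) (spineLaw (normalizedTerm ν α) ν) := by
  have := isProbabilityMeasure_spineLaw (ν := ν) measurable_normalizedTerm
    (lintegral_tsum_normalizedTerm h0 hm)
  exact (((integrable_entry h0 hm').const_mul (-α)).sub (integrable_const _)).congr
    ((ae_logWeight_normalizedTerm h0 hm).mono fun z hz => hz.symm)

/-- The log weight of a chosen child is -α X_i - log m(α), and the biased mean of X_i is
-m'(α)/m(α). Thus the inequality in (iv) becomes negativity of this integral. -/
lemma integral_logWeight_normalizedTerm (h0 : m ν α ≠ 0) (hm : m ν α < ∞)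
    (hm' : FiniteDeriv ν α) :
    ∫ z, logWeight (normalizedTerm ν α) z ∂(spineLaw (normalizedTerm ν α) ν) =
      α * mDeriv ν α / (m ν α).toReal - Real.log (m ν α).toReal := by
  have := isProbabilityMeasure_spineLaw (ν := ν) measurable_normalizedTerm
    (lintegral_tsum_normalizedTerm h0 hm)
  rw [integral_congr_ae (ae_logWeight_normalizedTerm h0 hm),
    integral_sub ((integrable_entry h0 hm').const_mul (-α)) (integrable_const _),
    integral_const_mul, integral_entry h0 hm', integral_const, probReal_univ, one_smul]
  ring

end NormalizedTerm

variable {Ω : Type*} {ν : Measure Tuple} {α : ℝ} {𝓛 : List ℕ → Ω → Tuple}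

open Classical in
lemma weight_normalizedTerm (ω : Ω) (σ : List ℕ) :
    weight (normalizedTerm ν α) (fun τ => 𝓛 τ ω) σ =
      (m ν α)⁻¹ ^ σ.length *
        if BRW.Born 𝓛 ω σ then ENNReal.ofReal (Real.exp (-α * position 𝓛 ω σ)) else 0 := by
  induction σ with
  | nil => simp [weight, BRW.Born, position]
  | cons i σ ih =>
    rw [weight, ih, normalizedTerm, expTerm]
    simp only [position, List.length_cons, pow_succ]
    by_cases h1 : BRW.Born 𝓛 ω σ
    · by_cases h2 : (i : ℕ∞) < (𝓛 σ ω).len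
      · have h : BRW.Born 𝓛 ω (i :: σ) := ⟨h1, h2⟩
        rw [if_pos h1, if_pos h2, if_pos h, mul_add, Real.exp_add,
          ENNReal.ofReal_mul (Real.exp_pos _).le]
        ring
      · have h : ¬ BRW.Born 𝓛 ω (i :: σ) := fun h => h2 h.2
        simp [h, h2]
    · have h : ¬ BRW.Born 𝓛 ω (i :: σ) := fun h => h1 h.1
      simp [h, h1]

lemma mass_normalizedTerm (n : ℕ) (ω : Ω) :
    mass (normalizedTerm ν α) n (fun τ => 𝓛 τ ω) = additiveMartingale ν 𝓛 α n ω := by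
  classical
  unfold mass additiveMartingale
  simp_rw [weight_normalizedTerm]
  refine (tsum_subtype {σ : List ℕ | σ.length = n} fun σ => (m ν α)⁻¹ ^ σ.length *
    if BRW.Born 𝓛 ω σ then ENNReal.ofReal (Real.exp (-α * position 𝓛 ω σ)) else 0).trans ?_
  rw [tsum_subtype (generation 𝓛 n ω)
      fun σ => ENNReal.ofReal (Real.exp (-α * position 𝓛 ω σ)),
    div_eq_mul_inv, ENNReal.inv_pow, mul_comm, ← ENNReal.tsum_mul_left]
  congr 1 with σ
  by_cases h1 : σ.length = n
  · by_cases h2 : BRW.Born 𝓛 ω σ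
    · have hmem : σ ∈ generation 𝓛 n ω := ⟨h1, h2⟩
      simp [h1, h2, hmem]
    · have hmem : σ ∉ generation 𝓛 n ω := fun h => h2 h.2
      simp [h2, hmem]
  · have hmem : σ ∉ generation 𝓛 n ω := fun h => h1 h.1
    simp [h1, hmem]

lemma limitMass_normalizedTerm (ω : Ω) :
    limitMass (normalizedTerm ν α) (fun τ => 𝓛 τ ω) = limitW ν 𝓛 α ω := by
  unfold limitMass limitW
  simp_rw [mass_normalizedTerm]

lemma mem_extinctionSet_iff (hm : m ν α < ∞) (ω : Ω) :
    (fun τ => 𝓛 τ ω) ∈ extinctionSet (normalizedTerm ν α) ↔ ω ∈ extinction 𝓛 := by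
  refine exists_congr fun n => ?_
  unfold mass
  rw [ENNReal.tsum_eq_zero, Set.eq_empty_iff_forall_notMem]
  have hw : ∀ σ, weight (normalizedTerm ν α) (fun τ => 𝓛 τ ω) σ = 0 ↔ ¬ BRW.Born 𝓛 ω σ := by
    intro σ
    rw [weight_normalizedTerm]
    by_cases h : BRW.Born 𝓛 ω σ
    · simp [h, Real.exp_pos, hm.ne]
    · simp [h]
  constructor
  · exact fun h σ hσ => (hw σ).1 (h ⟨σ, hσ.1⟩) hσ.2
  · exact fun h σ => (hw σ).2 fun hB => h σ ⟨σ.2, hB⟩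

/-- Independence and the common law determine the joint law of all labels, so statements on the
canonical tree space carry over to any realisation. -/
lemma measurePreserving_labels [MeasurableSpace Ω] {P : Measure Ω} [IsProbabilityMeasure P]
    [IsProbabilityMeasure ν] (h𝓛 : IsBranchingRandomWalk P ν 𝓛) :
    MeasurePreserving (fun ω σ => 𝓛 σ ω) P (treeLaw ν) := by
  refine ⟨measurable_pi_lambda _ h𝓛.measurable, ?_⟩
  rw [h𝓛.indep.map_fun_eq_infinitePi_map h𝓛.measurable]
  simp_rw [h𝓛.law]

end Transfer

end Cascade

/-! ### Biggins' theorem. -/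

theorem mainTheorem1 {Ω : Type*} [MeasurableSpace Ω] (P : Measure Ω) [IsProbabilityMeasure P]
    (ν : Measure BRW.Tuple) (𝓛 : List ℕ → Ω → BRW.Tuple)
    (h𝓛 : BRW.IsBranchingRandomWalk P ν 𝓛)
    (hsuper : 1 < BRW.m ν 0)
    (α : ℝ) (hm : BRW.m ν α < ∞) (hm' : BRW.FiniteDeriv ν α) :
    (∀ᵐ ω ∂P, BRW.limitW ν 𝓛 α ω < ∞ ∧
      Tendsto (fun n : ℕ => BRW.additiveMartingale ν 𝓛 α n ω) atTop
        (𝓝 (BRW.limitW ν 𝓛 α ω))) ∧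
    List.TFAE [
      P {ω | BRW.limitW ν 𝓛 α ω = 0} = P (BRW.extinction 𝓛),
      P {ω | BRW.limitW ν 𝓛 α ω = 0} < 1,
      ∫⁻ ω, BRW.limitW ν 𝓛 α ω ∂P = 1,
      ∫⁻ t, BRW.pairing α t * BRW.logPlus (BRW.pairing α t) ∂ν < ∞ ∧
        α * BRW.mDeriv ν α / (BRW.m ν α).toReal < Real.log (BRW.m ν α).toReal] := by
  have hν : IsProbabilityMeasure ν := by
    rw [← h𝓛.law []]
    exact Measure.isProbabilityMeasure_map (h𝓛.measurable []).aemeasurable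
  have h0 := Cascade.m_ne_zero hsuper α
  set a := Cascade.normalizedTerm ν α
  have ha : ∀ i, Measurable fun t => a t i := Cascade.measurable_normalizedTerm
  have hfin : ∀ t i, a t i ≠ ∞ := Cascade.normalizedTerm_ne_top h0
  have h1 : ∫⁻ t, ∑' i, a t i ∂ν = 1 := Cascade.lintegral_tsum_normalizedTerm h0 hm
  have hN : 1 < ∫⁻ t, Cascade.childCount a t ∂ν := by
    rw [lintegral_congr fun t => Cascade.childCount_normalizedTerm hm t]
    exact hsuper
  have hlog := Cascade.integrable_logWeight_normalizedTerm h0 hm hm'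
  have hmp := Cascade.measurePreserving_labels h𝓛
  have hWm := Cascade.measurable_limitMass (a := a) ha
  have hzero : P {ω | BRW.limitW ν 𝓛 α ω = 0} =
      Cascade.treeLaw ν {x | Cascade.limitMass a x = 0} := by
    simp_rw [← Cascade.limitMass_normalizedTerm]
    exact hmp.measure_preimage (hWm (measurableSet_singleton 0)).nullMeasurableSet
  have hext : P (BRW.extinction 𝓛) = Cascade.treeLaw ν (Cascade.extinctionSet a) := by
    have hme : MeasurableSet (Cascade.extinctionSet a) := by
      have : Cascade.extinctionSet a = ⋃ n, Cascade.mass a n ⁻¹' {0} := by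
        ext x
        simp [Cascade.extinctionSet]
      rw [this]
      exact MeasurableSet.iUnion fun n =>
        Cascade.measurable_mass ha n (measurableSet_singleton 0)
    rw [← hmp.measure_preimage hme.nullMeasurableSet]
    congr 1 with ω
    exact (Cascade.mem_extinctionSet_iff hm ω).symm
  have hmean : ∫⁻ ω, BRW.limitW ν 𝓛 α ω ∂P = ∫⁻ x, Cascade.limitMass a x ∂(Cascade.treeLaw ν) := by
    rw [← hmp.lintegral_comp hWm]
    simp_rw [← Cascade.limitMass_normalizedTerm]
    rfl
  refine ⟨?_, ?_⟩
  · filter_upwards [hmp.quasiMeasurePreserving.ae (Cascade.ae_tendsto_limitMass ha h1)] with ω hω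
    simp_rw [← Cascade.mass_normalizedTerm, ← Cascade.limitMass_normalizedTerm]
    exact hω
  -- All four conditions are moved to the canonical tree with normalized weights, where the
  -- inequality in (iv) reads κ < 0.
  rw [Cascade.lintegral_pairing_mul_logPlus_iff h0 hm,
    ← sub_neg (a := α * BRW.mDeriv ν α / (BRW.m ν α).toReal),
    ← Cascade.integral_logWeight_normalizedTerm h0 hm hm', hzero, hext, hmean]
  tfae_have 1 → 2 := fun h => by
    rw [h]
    exact Cascade.treeLaw_extinctionSet_lt_one ha h1 hN
  tfae_have 2 → 1 := Cascade.treeLaw_limitMass_eq_zero ha hfin h1 hN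
  tfae_have 3 → 2 := fun h => by
    refine lt_of_le_of_ne prob_le_one fun hW => ?_
    have hW0 : ∀ᵐ x ∂(Cascade.treeLaw ν), Cascade.limitMass a x = 0 :=
      (prob_compl_eq_zero_iff (hWm (measurableSet_singleton 0))).2 hW
    rw [lintegral_congr_ae hW0] at h
    simp at h
  tfae_have 4 → 3 := fun h =>
    Cascade.lintegral_limitMass_eq_one ha hfin h1 hlog h.2 h.1
  tfae_have 2 → 4 := fun h =>
    ⟨Cascade.lintegral_mul_logPlus_lt_top_of_limitMass ha hfin h1 hlog h,
      Cascade.integral_logWeight_neg ha hfin h1 hN hlog h⟩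
  tfae_finish
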